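/- **Proposition 4.1** ($L^q$ restriction estimate for $\beta_R$). *Setting.* Write $e_m(x):=\exp(2\pi i x/m)$, $\mathbb{Z}_m:=\mathbb{Z}/m\mathbb{Z}$, and $\mathbb{Z}_m^*:=\{c\in\mathbb{Z}_m:(c,m)=1\}$. Let $F(n)=\prod_{j=1}^k(a_jn+b_j)$, where $k\ge 1$, $a_j,b_j\in\mathbb{Z}$ and $a_j\neq0$, have non-zero discriminant $\prod_{1\le i<j\le k}(a_ib_j-a_jb_i)\neq0$. For $m\ge1$ let $$X_m:=\{n\in\mathbb{Z}_m:(m,F(n))=1\},\qquad \gamma(m):=|X_m|/m,$$ and assume that $\gamma(m)>0$ for all $m\ge1$. For an integer $R\ge1$ the enveloping sieve $\beta_R:\mathbb{Z}\to[0,\infty)$ attached to $F$ is $$\beta_R(n):=\frac{|\alpha_R(n)|^2}{G(R)},\qquad \alpha_R(n):=\sum_{m\le R}\ \sum_{c\in\mathbb{Z}_m^*}s(c/m)\,e_m(-cn),\qquad s(c/m):=\frac1{|X_m|}\sum_{n\in X_m}e_m(cn),$$ $$G(R):=\sum_{m\le R}h(m),\qquad h(m):=\mu(m)^2\prod_{p\mid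 m}\frac{1-\gamma(p)}{\gamma(p)}.$$ *Claim.* For every $k\ge1$, every real $1<q<2$ and every $A>0$ there is a constant $C=C(q,k,A)>0$ such that the following holds. Let $N,R\ge1$ be integers with $R\le A\,N^{1/10}$, and let $F$ be as above with $|a_j|,|b_j|\le N$ for all $j$ and with $F(n)\ne0$ for all integers $1\le n\le N$. Then for every $f:\mathbb{Z}_N\to\mathbb{C}$, $$\frac1N\sum_{n=1}^N\Bigl|\sum_{b\in\mathbb{Z}_N}f(b)\,e_N(bn)\Bigr|^2\beta_R(n)\ \le\ C\Bigl(\sum_{b\in\mathbb{Z}_N}|f(b)|^q\Bigr)^{2/q}.$$ -/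

import Mathlib

noncomputable section

namespace EnvelopingSieve

open Finset

/-- The additive character `e_m(x) = exp(2 π i x / m)`. -/
def e (m : ℕ) (x : ℤ) : ℂ :=
  Complex.exp (2 * Real.pi * Complex.I * ((x : ℂ) / (m : ℂ)))

/-- `F(n) = ∏_j (a_j n + b_j)`, a product of `k` integer linear forms. -/
def F {k : ℕ} (a b : Fin k → ℤ) (n : ℤ) : ℤ :=
  ∏ j, (a j * n + b j)

/-- The discriminant `∏_{i < j} (a_i b_j - a_j b_i)`. -/
def disc {k : ℕ} (a b : Fin k → ℤ) : ℤ :=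
  ∏ i, ∏ j ∈ Ioi i, (a i * b j - a j * b i)

/-- `X_q = {n ∈ ℤ/qℤ : (q, F(n)) = 1}`, with `ℤ/qℤ` identified with `{0, …, q - 1}`. -/
def X {k : ℕ} (a b : Fin k → ℤ) (q : ℕ) : Finset ℕ :=
  (range q).filter fun n => Int.gcd (q : ℤ) (F a b (n : ℤ)) = 1

/-- `γ(q) = |X_q| / q`. -/
def gamma {k : ℕ} (a b : Fin k → ℤ) (q : ℕ) : ℝ :=
  ((X a b q).card : ℝ) / (q : ℝ)

/-- `ℤ_q^*`, identified with the `c ∈ {0, …, q - 1}` that are coprime to `q`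
(for `q = 1` this is `{0}`). -/
def reducedResidues (q : ℕ) : Finset ℕ :=
  (range q).filter fun c => Nat.Coprime c q

/-- The normalised Fourier coefficient `s(c/q) = 𝔼_{n ∈ X_q} e_q(c n)`. -/
def s {k : ℕ} (a b : Fin k → ℤ) (c q : ℕ) : ℂ :=
  (∑ n ∈ X a b q, e q ((c : ℤ) * (n : ℤ))) / ((X a b q).card : ℂ)

/-- `α_R(n) = ∑_{q ≤ R} ∑_{c ∈ ℤ_q^*} s(c/q) e_q(-c n)`. -/
def alpha {k : ℕ} (a b : Fin k → ℤ) (R : ℕ) (n : ℤ) : ℂ :=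
  ∑ q ∈ Icc 1 R, ∑ c ∈ reducedResidues q, s a b c q * e q (-((c : ℤ) * n))

/-- `h(q) = μ(q)² ∏_{p ∣ q} (1 - γ(p)) / γ(p)`, the product being over primes. -/
def h {k : ℕ} (a b : Fin k → ℤ) (q : ℕ) : ℝ :=
  (ArithmeticFunction.moebius q : ℝ) ^ 2 *
    ∏ p ∈ q.primeFactors, (1 - gamma a b p) / gamma a b p

/-- `G(R) = ∑_{q ≤ R} h(q)`. -/
def G {k : ℕ} (a b : Fin k → ℤ) (R : ℕ) : ℝ :=
  ∑ q ∈ Icc 1 R, h a b q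

/-- The enveloping sieve `β_R(n) = |α_R(n)|² / G(R)`. -/
def beta {k : ℕ} (a b : Fin k → ℤ) (R : ℕ) (n : ℤ) : ℝ :=
  ‖alpha a b R n‖ ^ 2 / G a b R

end EnvelopingSieve

end

noncomputable section

namespace EnvelopingSieve

open Finset

section

/-! ### Additive characters -/

/-! The weight `β_R` is a trigonometric polynomial supported on fractions `c/m` with `m ≤ R²`, with
coefficients of size about `m^(-1+ε)`. To see this, note that the part of `α_R(n)` with denominator
`m` is multiplicative in `m`. It vanishes unless `m` is square-free, and then equals the product
over `p ∣ m` of `ψ_p(n)`, which is `-1` if `p ∣ F(n)` and `h(p)` otherwise. Since `ψ_p² = h(p) +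
(h(p) - 1) ψ_p`, the square of `α_R` is again a combination of such products. Division by `G(R)`
leaves coefficients of size at most `(4k(k+1))^ω(m)` (`exists_beta_expansion`).

The core is the case of `f` bounded by `L` and supported on `M` points, where the weighted sum is `≪
N L² M^(1+ε)` (`exists_restricted_le`). If `M` exceeds a fixed small power of `N`, the divisor bound
`β_R ≪ N^δ` (`exists_beta_le`) and Parseval suffice. Otherwise the expansion is cut at `m = M`.

Moduli above `M` have Fourier coefficients `≪ N M^(ε-1) + N^(7/10)`, because reduced fractions are
well spaced (`exists_tail_le`). This beats the factor `(ML)²` lost by summing absolute values over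
pairs of frequencies. Moduli up to `M` are dominated by a divisor-type function of `F(n)` all of
whose moments are small (`exists_moment_le`). It exceeds `M^ε` so rarely that the trivial bound `ML`
for the exponential sum is enough there, and Parseval treats the other `n`.

A general `f` is cut into dyadic levels of `|f|`. With `q(1+ε) < 2` the contributions of the levels
decay geometrically, and a weighted Cauchy-Schwarz inequality adds them up
(`exists_restriction_le`). -/

lemma e_zero (m : ℕ) : e m 0 = 1 := by simp [e]

lemma e_add (m : ℕ) (x y : ℤ) : e m (x + y) = e m x * e m y := by
  unfold e
  rw [← Complex.exp_add]
  congr 1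
  push_cast
  ring

lemma norm_e (m : ℕ) (x : ℤ) : ‖e m x‖ = 1 := by
  unfold e
  have : 2 * (Real.pi : ℂ) * Complex.I * ((x : ℂ) / (m : ℂ))
      = ((2 * Real.pi * ((x : ℝ) / (m : ℝ)) : ℝ) : ℂ) * Complex.I := by
    push_cast
    ring
  rw [this, Complex.norm_exp_ofReal_mul_I]

lemma e_ne_zero (m : ℕ) (x : ℤ) : e m x ≠ 0 := Complex.exp_ne_zero _

lemma e_neg (m : ℕ) (x : ℤ) : e m (-x) = (e m x)⁻¹ := by
  refine eq_inv_of_mul_eq_one_left ?_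
  rw [← e_add, neg_add_cancel, e_zero]

lemma conj_e (m : ℕ) (x : ℤ) : (starRingEnd ℂ) (e m x) = e m (-x) := by
  rw [e_neg, Complex.inv_eq_conj (norm_e m x)]

lemma e_pow (m : ℕ) (x : ℤ) (n : ℕ) : e m x ^ n = e m (x * n) := by
  unfold e
  rw [← Complex.exp_nat_mul]
  congr 1
  push_cast
  ring

lemma e_eq_one_iff {m : ℕ} (hm : 0 < m) (x : ℤ) : e m x = 1 ↔ (m : ℤ) ∣ x := by
  have hm' : (m : ℂ) ≠ 0 := by exact_mod_cast hm.ne'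
  have hpi : (2 * (Real.pi : ℂ) * Complex.I) ≠ 0 := Complex.two_pi_I_ne_zero
  unfold e
  rw [Complex.exp_eq_one_iff]
  constructor
  · rintro ⟨n, hn⟩
    rw [mul_comm, mul_left_inj' hpi, div_eq_iff hm'] at hn
    exact ⟨n, by rw [mul_comm]; exact_mod_cast hn⟩
  · rintro ⟨n, rfl⟩
    refine ⟨n, ?_⟩
    push_cast
    field_simp

lemma e_congr {m : ℕ} {x y : ℤ} (h : x ≡ y [ZMOD m]) : e m x = e m y := by
  rcases Nat.eq_zero_or_pos m with rfl | hm
  · simp [e]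
  · obtain ⟨t, ht⟩ := h.dvd
    have : y = x + m * t := by linarith
    rw [this, e_add, (e_eq_one_iff hm _).2 ⟨t, rfl⟩, mul_one]

lemma e_mul_add {m n : ℕ} (hm : 0 < m) (hn : 0 < n) (x y : ℤ) :
    e (m * n) (n * x + m * y) = e m x * e n y := by
  have hm' : (m : ℂ) ≠ 0 := by exact_mod_cast hm.ne'
  have hn' : (n : ℂ) ≠ 0 := by exact_mod_cast hn.ne'
  unfold e
  rw [← Complex.exp_add]
  congr 1
  push_cast
  field_simp

lemma sum_pow_eq_zero_of_pow_eq_one {z : ℂ} {M : ℕ} (hz : z ^ M = 1) (h1 : z ≠ 1) :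
    ∑ i ∈ range M, z ^ i = 0 := by
  rw [geom_sum_eq h1, hz, sub_self, zero_div]

lemma sum_e_mul {m : ℕ} (hm : 0 < m) (c : ℤ) :
    ∑ n ∈ range m, e m (c * n) = if (m : ℤ) ∣ c then (m : ℂ) else 0 := by
  simp_rw [← e_pow]
  split_ifs with h
  · simp [(e_eq_one_iff hm c).2 h]
  · refine sum_pow_eq_zero_of_pow_eq_one ?_ (fun h1 => h ((e_eq_one_iff hm c).1 h1))
    rw [e_pow, e_eq_one_iff hm]
    exact dvd_mul_left _ _

/-- A non-trivial `M`-th root of unity is not close to `1`. -/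
lemma one_le_mul_norm_root_sub_one {z : ℂ} {M : ℕ} (hM : 0 < M) (hz : z ^ M = 1) (h1 : z ≠ 1)
    (hn : ‖z‖ = 1) : 1 ≤ (M : ℝ) * ‖z - 1‖ := by
  have hstep : ∀ i : ℕ, ‖1 - z ^ i‖ ≤ i * ‖z - 1‖ := by
    intro i
    induction i with
    | zero => simp
    | succ i ih =>
      have : 1 - z ^ (i + 1) = (1 - z ^ i) - z ^ i * (z - 1) := by ring
      rw [this]
      refine (norm_sub_le _ _).trans ?_
      rw [norm_mul, norm_pow, hn, one_pow, one_mul]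
      push_cast
      linarith
  -- The powers of `z` over a full period cancel, so only the `M` ones survive.
  have hsum : (M : ℂ) = ∑ i ∈ range M, (1 - z ^ i) := by
    rw [sum_sub_distrib, sum_pow_eq_zero_of_pow_eq_one hz h1]
    simp
  have hM' : (0 : ℝ) < M := by exact_mod_cast hM
  have : (M : ℝ) ≤ M * (M * ‖z - 1‖) := by
    calc (M : ℝ) = ‖(M : ℂ)‖ := by simp
      _ ≤ ∑ i ∈ range M, ‖1 - z ^ i‖ := by
        rw [hsum]
        exact norm_sum_le _ _
      _ ≤ ∑ i ∈ range M, (M : ℝ) * ‖z - 1‖ := by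
        refine sum_le_sum fun i hi => (hstep i).trans ?_
        have : (i : ℝ) ≤ M := by exact_mod_cast (mem_range.1 hi).le
        gcongr
      _ = M * (M * ‖z - 1‖) := by simp
  exact le_of_mul_le_mul_left (by linarith) hM'

/-! ### Sums over complete residue systems -/

/-- `f` depends only on the residue class modulo `m`. -/
def Periodic (m : ℕ) (f : ℤ → ℂ) : Prop :=
  ∀ x y : ℤ, x ≡ y [ZMOD m] → f x = f y

lemma sum_complete {m : ℕ} (hm : 0 < m) {f : ℤ → ℂ} (hf : Periodic m f) (φ : ℕ → ℤ)
    (hφ : ∀ i < m, ∀ j < m, φ i ≡ φ j [ZMOD m] → i = j) :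
    ∑ i ∈ range m, f (φ i) = ∑ i ∈ range m, f i := by
  have hm' : (0 : ℤ) < m := by exact_mod_cast hm
  have key : ∀ i, (((φ i % m).toNat : ℕ) : ℤ) = φ i % m := fun i =>
    Int.toNat_of_nonneg (Int.emod_nonneg _ hm'.ne')
  have hmaps : Set.MapsTo (fun i => (φ i % m).toNat) (range m : Set ℕ) (range m : Set ℕ) := by
    intro i _
    have := Int.emod_lt_of_pos (φ i) hm'
    have h2 := key i
    simp only [coe_range, Set.mem_Iio]
    omega
  have hinj : Set.InjOn (fun i => (φ i % m).toNat) (range m : Set ℕ) := by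
    intro i hi j hj hij
    simp only [coe_range, Set.mem_Iio] at hi hj
    refine hφ i hi j hj ?_
    have : (((φ i % m).toNat : ℕ) : ℤ) = ((φ j % m).toNat : ℕ) := by exact_mod_cast hij
    rw [key, key] at this
    exact this
  refine sum_nbij (fun i => (φ i % m).toNat) (fun i hi => by simpa using hmaps hi) hinj
    (surjOn_of_injOn_of_card_le _ hmaps hinj le_rfl) ?_
  intro i _
  refine hf _ _ ?_
  rw [key]
  exact (Int.mod_modEq _ _).symm

lemma sum_coprime_mul {m n : ℕ} (hm : 0 < m) (hn : 0 < n) (hmn : m.Coprime n) {f g : ℤ → ℂ}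
    (hf : Periodic m f) (hg : Periodic n g) :
    ∑ i ∈ range (m * n), f i * g i = (∑ i ∈ range m, f i) * ∑ j ∈ range n, g j := by
  rw [sum_mul_sum, ← sum_product']
  have hmaps : Set.MapsTo (fun i : ℕ => (i % m, i % n)) (range (m * n) : Set ℕ)
      (range m ×ˢ range n : Finset (ℕ × ℕ)) := by
    intro i _
    simp [Nat.mod_lt _ hm, Nat.mod_lt _ hn]
  have hinj : Set.InjOn (fun i : ℕ => (i % m, i % n)) (range (m * n) : Set ℕ) := by
    intro i hi j hj hij
    simp only [coe_range, Set.mem_Iio] at hi hj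
    simp only [Prod.mk.injEq] at hij
    have := (Nat.modEq_and_modEq_iff_modEq_mul hmn).1 hij
    exact Nat.ModEq.eq_of_lt_of_lt this hi hj
  refine sum_nbij (fun i : ℕ => (i % m, i % n)) (fun i hi => by simpa using hmaps hi) hinj
    (surjOn_of_injOn_of_card_le _ hmaps hinj (by simp)) ?_
  intro i _
  have h1 : f i = f ((i % m : ℕ) : ℤ) := hf _ _ (by
    push_cast
    exact (Int.mod_modEq _ _).symm)
  have h2 : g i = g ((i % n : ℕ) : ℤ) := hg _ _ (by
    push_cast
    exact (Int.mod_modEq _ _).symm)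
  simp only
  rw [← h1, ← h2]

lemma sum_mul_unit {m : ℕ} (hm : 0 < m) {f : ℤ → ℂ} (hf : Periodic m f) {u : ℤ}
    (hu : IsCoprime u (m : ℤ)) :
    ∑ i ∈ range m, f (i * u) = ∑ i ∈ range m, f i := by
  refine sum_complete hm hf (fun i => i * u) ?_
  intro i hi j hj hij
  have h1 : (m : ℤ) ∣ (j - i) * u := by
    have := hij.dvd
    rwa [← sub_mul] at this
  have h2 : (m : ℤ) ∣ j - i := hu.symm.dvd_of_dvd_mul_right h1
  have h3 : (i : ℤ) ≡ j [ZMOD m] := Int.modEq_iff_dvd.2 h2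
  exact Nat.ModEq.eq_of_lt_of_lt (Int.natCast_modEq_iff.1 h3) hi hj

lemma sum_add_shift {m : ℕ} (hm : 0 < m) {f : ℤ → ℂ} (hf : Periodic m f) (t : ℤ) :
    ∑ i ∈ range m, f (i + t) = ∑ i ∈ range m, f i := by
  refine sum_complete hm hf (fun i => i + t) ?_
  intro i hi j hj hij
  have h3 : (i : ℤ) ≡ j [ZMOD m] := Int.ModEq.add_right_cancel' t hij
  exact Nat.ModEq.eq_of_lt_of_lt (Int.natCast_modEq_iff.1 h3) hi hj

/-! ### The Fourier coefficients of the local indicator -/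

variable {k : ℕ} (a b : Fin k → ℤ)

lemma F_modEq {m x y : ℤ} (h : x ≡ y [ZMOD m]) : F a b x ≡ F a b y [ZMOD m] := by
  unfold F
  exact Int.ModEq.prod fun j _ => (h.mul_left _).add_right _

lemma gcd_F_congr {m : ℕ} {x y : ℤ} (h : x ≡ y [ZMOD m]) :
    Int.gcd (m : ℤ) (F a b x) = Int.gcd (m : ℤ) (F a b y) := by
  obtain ⟨t, ht⟩ := (F_modEq a b h).dvd
  have : F a b y = F a b x + m * t := by linarith
  rw [this]
  simp

/-- Fourier transform of the indicator function of `X_q`, unnormalised. -/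
def sNum (c : ℤ) (q : ℕ) : ℂ := ∑ n ∈ X a b q, e q (c * n)

lemma sNum_eq (c : ℤ) (q : ℕ) :
    sNum a b c q = ∑ n ∈ range q, if Int.gcd (q : ℤ) (F a b (n : ℤ)) = 1 then
      e q (c * n) else 0 := by
  rw [sNum, X, sum_filter]

lemma sNum_zero (q : ℕ) : sNum a b 0 q = (X a b q).card := by
  simp [sNum, e_zero]

lemma sNum_periodic (q : ℕ) : Periodic q (fun c => sNum a b c q) := by
  intro x y h
  exact sum_congr rfl fun n _ => e_congr (h.mul_right _)

/-- Chinese remainder theorem: the relation `un + vm = 1` splits `c/(mn)` as `cu/m + cv/n`, and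
coprimality to `mn` is coprimality to both factors. -/
lemma sNum_mul {m n : ℕ} (hm : 0 < m) (hn : 0 < n) (hmn : m.Coprime n) {u v : ℤ}
    (huv : u * n + v * m = 1) (c : ℤ) :
    sNum a b c (m * n) = sNum a b (c * u) m * sNum a b (c * v) n := by
  simp only [sNum_eq]
  rw [← sum_coprime_mul hm hn hmn
    (f := fun i => if Int.gcd (m : ℤ) (F a b i) = 1 then e m (c * u * i) else 0)
    (g := fun i => if Int.gcd (n : ℤ) (F a b i) = 1 then e n (c * v * i) else 0)]
  · refine sum_congr rfl fun i _ => ?_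
    have h1 : Int.gcd ((m * n : ℕ) : ℤ) (F a b i) = 1 ↔
        Int.gcd (m : ℤ) (F a b i) = 1 ∧ Int.gcd (n : ℤ) (F a b i) = 1 := by
      simp only [← Int.isCoprime_iff_gcd_eq_one]
      push_cast
      exact IsCoprime.mul_left_iff
    have h2 : e (m * n) (c * i) = e m (c * u * i) * e n (c * v * i) := by
      rw [← e_mul_add hm hn]
      congr 1
      linear_combination (-c * i) * huv
    by_cases h3 : Int.gcd (m : ℤ) (F a b i) = 1 <;>
      by_cases h4 : Int.gcd (n : ℤ) (F a b i) = 1 <;> simp only [h1, h3, h4, h2] <;> simp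
  · intro x y h
    simp only [gcd_F_congr a b h, e_congr (h.mul_left (c * u))]
  · intro x y h
    simp only [gcd_F_congr a b h, e_congr (h.mul_left (c * v))]

/-- `s(c/q)` for an arbitrary integer `c`. -/
def sInt (c : ℤ) (q : ℕ) : ℂ := sNum a b c q / ((X a b q).card : ℂ)

lemma s_eq_sInt (c q : ℕ) : s a b c q = sInt a b c q := rfl

lemma card_X_mul {m n : ℕ} (hm : 0 < m) (hn : 0 < n) (hmn : m.Coprime n) :
    ((X a b (m * n)).card : ℂ) = (X a b m).card * (X a b n).card := by
  obtain ⟨u, v, huv⟩ := (Nat.isCoprime_iff_coprime.2 hmn).symm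
  have := sNum_mul a b hm hn hmn huv 0
  simpa [sNum_zero] using this

lemma sInt_mul {m n : ℕ} (hm : 0 < m) (hn : 0 < n) (hmn : m.Coprime n) {u v : ℤ}
    (huv : u * n + v * m = 1) (c : ℤ) :
    sInt a b c (m * n) = sInt a b (c * u) m * sInt a b (c * v) n := by
  rw [sInt, sInt, sInt, sNum_mul a b hm hn hmn huv, card_X_mul a b hm hn hmn, mul_div_mul_comm]

lemma sInt_periodic (q : ℕ) : Periodic q (fun c => sInt a b c q) := by
  intro x y h
  have : sNum a b x q = sNum a b y q := sNum_periodic a b q x y h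
  simp only [sInt, this]

/-- The part of `α_R(n)` with denominator `q`. -/
def alphaPart (q : ℕ) (n : ℤ) : ℂ :=
  ∑ c ∈ reducedResidues q, s a b c q * e q (-((c : ℤ) * n))

lemma alphaPart_eq (q : ℕ) (n : ℤ) : alphaPart a b q n =
    ∑ c ∈ range q, if Int.gcd (c : ℤ) (q : ℤ) = 1 then
      sInt a b c q * e q (-((c : ℤ) * n)) else 0 := by
  rw [alphaPart, reducedResidues, sum_filter]
  rfl

lemma alphaPart_summand_periodic (q : ℕ) (n : ℤ) :
    Periodic q (fun c : ℤ => if Int.gcd c (q : ℤ) = 1 then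
      sInt a b c q * e q (-(c * n)) else 0) := by
  intro x y h
  have h1 : Int.gcd x (q : ℤ) = Int.gcd y (q : ℤ) := by
    obtain ⟨t, ht⟩ := h.dvd
    have : y = x + q * t := by linarith
    rw [this]
    simp
  have h2 : sInt a b x q = sInt a b y q := sInt_periodic a b q x y h
  simp only [h1, h2, e_congr (h.mul_right n).neg]

/-- The twists by `u` and `v` coming from the Chinese remainder theorem disappear, since
multiplication by a unit permutes the reduced residues. -/
lemma alphaPart_mul {m n : ℕ} (hm : 0 < m) (hn : 0 < n) (hmn : m.Coprime n) (t : ℤ) :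
    alphaPart a b (m * n) t = alphaPart a b m t * alphaPart a b n t := by
  obtain ⟨u, v, huv⟩ := (Nat.isCoprime_iff_coprime.2 hmn).symm
  have hu : IsCoprime u (m : ℤ) := ⟨n, v, by linarith⟩
  have hv : IsCoprime v (n : ℤ) := ⟨m, u, by linarith⟩
  have key : ∀ {q : ℕ} {w : ℤ}, IsCoprime w (q : ℤ) → ∀ c : ℤ,
      (Int.gcd (c * w) (q : ℤ) = 1 ↔ Int.gcd c (q : ℤ) = 1) := by
    intro q w hw c
    simp only [← Int.isCoprime_iff_gcd_eq_one]
    exact ⟨fun h => h.of_mul_left_left, fun h => h.mul_left hw⟩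
  rw [alphaPart_eq, alphaPart_eq, alphaPart_eq,
    ← sum_mul_unit hm (alphaPart_summand_periodic a b m t) hu,
    ← sum_mul_unit hn (alphaPart_summand_periodic a b n t) hv,
    ← sum_coprime_mul hm hn hmn
      (f := fun c => if Int.gcd (c * u) (m : ℤ) = 1 then
        sInt a b (c * u) m * e m (-((c * u) * t)) else 0)
      (g := fun c => if Int.gcd (c * v) (n : ℤ) = 1 then
        sInt a b (c * v) n * e n (-((c * v) * t)) else 0)]
  · refine sum_congr rfl fun c _ => ?_
    have h1 : Int.gcd (c : ℤ) ((m * n : ℕ) : ℤ) = 1 ↔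
        Int.gcd (c : ℤ) (m : ℤ) = 1 ∧ Int.gcd (c : ℤ) (n : ℤ) = 1 := by
      simp only [← Int.isCoprime_iff_gcd_eq_one]
      push_cast
      exact IsCoprime.mul_right_iff
    have h2 : e (m * n) (-(c * t)) = e m (-((c * u) * t)) * e n (-((c * v) * t)) := by
      rw [← e_mul_add hm hn]
      congr 1
      linear_combination (c * t) * huv
    simp only [key hu, key hv]
    by_cases h3 : Int.gcd (c : ℤ) (m : ℤ) = 1 <;>
      by_cases h4 : Int.gcd (c : ℤ) (n : ℤ) = 1 <;> simp only [h1, h3, h4] <;> simp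
    rw [h2, sInt_mul a b hm hn hmn huv]
    ring
  · intro x y h
    exact alphaPart_summand_periodic a b m t _ _ (h.mul_right u)
  · intro x y h
    exact alphaPart_summand_periodic a b n t _ _ (h.mul_right v)

end

section

variable {k : ℕ} (a b : Fin k → ℤ)

/-! ### Local densities -/

/-- The value `h(p)` of the density function at a prime. -/
def ratio (p : ℕ) : ℝ := (1 - gamma a b p) / gamma a b p

/-- The roots of `F` modulo `p`. -/
def roots (p : ℕ) : Finset ℕ := (range p).filter fun n => (p : ℤ) ∣ F a b (n : ℤ)

lemma gcd_eq_one_iff_not_dvd {p : ℕ} (hp : p.Prime) (x : ℤ) :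
    Int.gcd (p : ℤ) x = 1 ↔ ¬ (p : ℤ) ∣ x := by
  rw [← Int.isCoprime_iff_gcd_eq_one]
  exact (Nat.prime_iff_prime_int.1 hp).coprime_iff_not_dvd

lemma card_X_add_card_roots {p : ℕ} (hp : p.Prime) :
    (X a b p).card + (roots a b p).card = p := by
  have : X a b p = (range p).filter fun n : ℕ => ¬ (p : ℤ) ∣ F a b (n : ℤ) := by
    unfold X
    exact filter_congr fun n _ => gcd_eq_one_iff_not_dvd hp _
  rw [this, roots, add_comm, card_filter_add_card_filter_not, card_range]

lemma card_X_pos {m : ℕ} (hm : 0 < m) (hγ : 0 < gamma a b m) : 0 < (X a b m).card := by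
  unfold gamma at hγ
  have hm' : (0 : ℝ) < m := by exact_mod_cast hm
  have := (div_pos_iff_of_pos_right hm').1 hγ
  exact_mod_cast this

/-- Positive density gives a point where `p` does not divide `F`. Hence no linear factor vanishes
identically modulo `p`, and each has at most one root. -/
lemma card_roots_le {p : ℕ} (hp : p.Prime) (hγ : 0 < gamma a b p) :
    (roots a b p).card ≤ k := by
  obtain ⟨x, hx⟩ := card_pos.1 (card_X_pos a b hp.pos hγ)
  simp only [X, mem_filter, gcd_eq_one_iff_not_dvd hp] at hx
  have hpp := Nat.prime_iff_prime_int.1 hp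
  have hsub : roots a b p ⊆ univ.biUnion fun j : Fin k =>
      (range p).filter fun n : ℕ => (p : ℤ) ∣ a j * n + b j := by
    intro n hn
    rw [roots, mem_filter, F] at hn
    obtain ⟨j, _, hj⟩ := (hpp.dvd_finsetProd_iff _).1 hn.2
    simp only [mem_biUnion, mem_filter]
    exact ⟨j, mem_univ _, hn.1, hj⟩
  refine (card_le_card hsub).trans (card_biUnion_le.trans ?_)
  have : ∀ j ∈ (univ : Finset (Fin k)),
      ((range p).filter fun n : ℕ => (p : ℤ) ∣ a j * n + b j).card ≤ 1 := by
    intro j _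
    rw [card_le_one]
    intro n hn n' hn'
    simp only [mem_filter, mem_range] at hn hn'
    have hsub : (p : ℤ) ∣ a j * (n - n') := by
      have := dvd_sub hn.2 hn'.2
      ring_nf at this ⊢
      exact this
    rcases hpp.dvd_or_dvd hsub with h | h
    · exfalso
      apply hx.2
      have hb : (p : ℤ) ∣ b j := (dvd_add_right (h.mul_right _)).1 hn.2
      exact (dvd_add (h.mul_right _) hb).trans (dvd_prod_of_mem _ (mem_univ j))
    · have : (n : ℤ) ≡ n' [ZMOD p] := (Int.modEq_iff_dvd.2 h).symm
      exact Nat.ModEq.eq_of_lt_of_lt (Int.natCast_modEq_iff.1 this) hn.1 hn'.1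
  exact (sum_le_sum this).trans (by simp)

lemma ratio_eq {p : ℕ} (hp : p.Prime) (hγ : 0 < gamma a b p) :
    ratio a b p = (roots a b p).card / (X a b p).card := by
  have h1 := card_X_pos a b hp.pos hγ
  have h2 : ((X a b p).card : ℝ) + (roots a b p).card = p := by
    exact_mod_cast card_X_add_card_roots a b hp
  have h3 : (0 : ℝ) < p := by exact_mod_cast hp.pos
  have h4 : (0 : ℝ) < (X a b p).card := by exact_mod_cast h1
  unfold ratio gamma
  field_simp
  linarith

lemma ratio_nonneg {p : ℕ} (hp : p.Prime) (hγ : 0 < gamma a b p) : 0 ≤ ratio a b p := by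
  rw [ratio_eq a b hp hγ]
  positivity

lemma ratio_le {p : ℕ} (hp : p.Prime) (hγ : 0 < gamma a b p) :
    ratio a b p ≤ (k * (k + 1) : ℝ) / p := by
  have h1 := card_X_pos a b hp.pos hγ
  have h2 := card_X_add_card_roots a b hp
  have hk := card_roots_le a b hp hγ
  rw [ratio_eq a b hp hγ]
  have h3 : (0 : ℝ) < p := by exact_mod_cast hp.pos
  have h4 : (0 : ℝ) < (X a b p).card := by exact_mod_cast h1
  rw [div_le_div_iff₀ h4 h3]
  -- Here `p = |X_p| + |roots| ≤ |X_p| + k` and `|X_p| ≥ 1`.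
  have : p ≤ (k + 1) * (X a b p).card := by nlinarith
  have h5 : (roots a b p).card * p ≤ k * ((k + 1) * (X a b p).card) := Nat.mul_le_mul hk this
  have h6 : ((roots a b p).card : ℝ) * p ≤ k * ((k + 1) * (X a b p).card) := by
    exact_mod_cast h5
  linarith

/-- The component at `p` of the sieve weight. -/
def psi (p : ℕ) (n : ℤ) : ℝ := if (p : ℤ) ∣ F a b n then -1 else ratio a b p

/-- The component of `α_R` attached to the square-free modulus `m`. -/
def psiProd (m : ℕ) (n : ℤ) : ℝ := ∏ p ∈ m.primeFactors, psi a b p n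

lemma psi_sq (p : ℕ) (n : ℤ) :
    psi a b p n ^ 2 = ratio a b p + (ratio a b p - 1) * psi a b p n := by
  unfold psi
  split_ifs <;> ring

/-! ### Fourier coefficients and sieve components at primes and prime powers -/

lemma sum_range_dvd_sub {p : ℕ} (hp : 0 < p) {g : ℤ → ℂ} (hg : Periodic p g) (n : ℤ) :
    (∑ x ∈ range p, if (p : ℤ) ∣ x - n then g x else 0) = g n := by
  have hper : Periodic p (fun x => if (p : ℤ) ∣ x - n then g x else 0) := by
    intro x y h
    have h1 : (p : ℤ) ∣ x - n ↔ (p : ℤ) ∣ y - n := by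
      have : y - n = (x - n) + (y - x) := by ring
      rw [this]
      exact (dvd_add_left h.dvd).symm
    simp only [h1, hg x y h]
  have h2 := sum_add_shift hp hper n
  simp only [add_sub_cancel_right] at h2
  rw [← h2, sum_eq_single 0]
  · simp
  · intro x hx hx0
    rw [if_neg]
    intro h
    exact hx0 (Nat.eq_zero_of_dvd_of_lt (Int.natCast_dvd_natCast.1 h) (mem_range.1 hx))
  · intro h
    exact absurd (mem_range.2 hp) h

/-- By Fourier inversion, the sum over all `c` modulo `p` is the indicator of `X_p` divided by
`γ(p)`. Removing the term `c = 0`, which is `1`, leaves `-1` or `1/γ(p) - 1`. -/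
lemma alphaPart_prime {p : ℕ} (hp : p.Prime) (hγ : 0 < gamma a b p) (n : ℤ) :
    alphaPart a b p n = psi a b p n := by
  have hX := card_X_pos a b hp.pos hγ
  have hXC : ((X a b p).card : ℂ) ≠ 0 := by exact_mod_cast hX.ne'
  have hall : ∑ c ∈ range p, sInt a b c p * e p (-((c : ℤ) * n)) =
      if (p : ℤ) ∣ F a b n then 0 else (p : ℂ) / (X a b p).card := by
    have h1 : ∑ c ∈ range p, sInt a b c p * e p (-((c : ℤ) * n)) =
        (∑ x ∈ range p, if (p : ℤ) ∣ x - n then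
          (if Int.gcd (p : ℤ) (F a b x) = 1 then (p : ℂ) else 0) else 0) / (X a b p).card := by
      simp only [sInt, sNum_eq, div_mul_eq_mul_div]
      rw [← sum_div]
      congr 1
      simp only [sum_mul]
      rw [sum_comm]
      refine sum_congr rfl fun x _ => ?_
      by_cases hx : Int.gcd (p : ℤ) (F a b x) = 1
      · simp only [hx, if_true]
        rw [← sum_e_mul hp.pos]
        refine sum_congr rfl fun c _ => ?_
        rw [← e_add]
        congr 1
        ring
      · simp [hx]
    rw [h1, sum_range_dvd_sub hp.pos
      (g := fun x => if Int.gcd (p : ℤ) (F a b x) = 1 then (p : ℂ) else 0)]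
    · simp only [gcd_eq_one_iff_not_dvd hp]
      split_ifs <;> simp
    · intro x y h
      simp only [gcd_F_congr a b h]
  have hsplit : alphaPart a b p n =
      ∑ c ∈ range p, sInt a b c p * e p (-((c : ℤ) * n)) - 1 := by
    rw [alphaPart_eq, range_eq_Ico, sum_eq_sum_Ico_succ_bot hp.pos,
      sum_eq_sum_Ico_succ_bot hp.pos]
    have h0 : Int.gcd ((0 : ℕ) : ℤ) (p : ℤ) ≠ 1 := by
      simpa using hp.ne_one
    rw [if_neg h0]
    have h1 : sInt a b ((0 : ℕ) : ℤ) p * e p (-(((0 : ℕ) : ℤ) * n)) = 1 := by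
      simp [sInt, sNum_zero, e_zero, hXC]
    rw [h1, zero_add, add_sub_cancel_left]
    refine sum_congr rfl fun c hc => ?_
    rw [if_pos]
    rw [mem_Ico] at hc
    rw [Int.gcd_comm, gcd_eq_one_iff_not_dvd hp, Int.natCast_dvd_natCast]
    exact Nat.not_dvd_of_pos_of_lt (by omega) hc.2
  rw [hsplit, hall, psi]
  split_ifs
  · simp
  · unfold ratio gamma
    have hp0 : (p : ℂ) ≠ 0 := by exact_mod_cast hp.ne_zero
    push_cast
    field_simp

/-- Membership in the set `X` of modulus `p^j` depends only on the class modulo `p`, so for `j ≥ 2`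
the set is invariant under translation by `p^(j-1)`. That translation multiplies the character by a
non-trivial root of unity. -/
lemma sInt_prime_pow_eq_zero {p j : ℕ} (hp : p.Prime) (hj : 2 ≤ j) {c : ℤ}
    (hc : IsCoprime c (p : ℤ)) : sInt a b c (p ^ j) = 0 := by
  have hm : 0 < p ^ j := pow_pos hp.pos j
  have hpow : p ^ j = p ^ (j - 1) * p := by
    rw [← pow_succ]
    congr 1
    omega
  rw [sInt, sNum_eq, div_eq_zero_iff]
  left
  set f : ℤ → ℂ := fun n => if Int.gcd ((p ^ j : ℕ) : ℤ) (F a b n) = 1 then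
      e (p ^ j) (c * n) else 0 with hf
  have hper : Periodic (p ^ j) f := by
    intro x y h
    simp only [hf, gcd_F_congr a b h, e_congr (h.mul_left c)]
  have hshift := sum_add_shift hm hper ((p ^ (j - 1) : ℕ) : ℤ)
  have hz : ∀ i : ℤ, f (i + ((p ^ (j - 1) : ℕ) : ℤ)) =
      f i * e (p ^ j) (c * ((p ^ (j - 1) : ℕ) : ℤ)) := by
    intro i
    have hg : Int.gcd ((p ^ j : ℕ) : ℤ) (F a b (i + ((p ^ (j - 1) : ℕ) : ℤ))) = 1 ↔
        Int.gcd ((p ^ j : ℕ) : ℤ) (F a b i) = 1 := by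
      simp only [← Int.isCoprime_iff_gcd_eq_one]
      push_cast
      rw [IsCoprime.pow_left_iff (by omega), IsCoprime.pow_left_iff (by omega),
        Int.isCoprime_iff_gcd_eq_one, Int.isCoprime_iff_gcd_eq_one]
      rw [gcd_F_congr a b]
      refine (Int.modEq_iff_dvd.2 ?_).symm
      rw [add_sub_cancel_left]
      exact dvd_pow_self _ (by omega)
    simp only [hf, hg]
    split_ifs
    · rw [← e_add, mul_add]
    · simp
  simp only [hz] at hshift
  rw [← sum_mul] at hshift
  by_contra hne
  have h1 : e (p ^ j) (c * ((p ^ (j - 1) : ℕ) : ℤ)) = 1 := by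
    have := mul_left_cancel₀ hne (hshift.trans (mul_one _).symm)
    exact this
  rw [e_eq_one_iff hm, hpow] at h1
  push_cast at h1
  rw [mul_comm, mul_dvd_mul_iff_right (pow_ne_zero _ (by exact_mod_cast hp.ne_zero))] at h1
  exact (Nat.prime_iff_prime_int.1 hp).not_isUnit (hc.isUnit_of_dvd' h1 dvd_rfl)

/-- A non-trivial character sums to zero, so the sum over `X_p` may be replaced by the sum over the
few roots. -/
lemma norm_sInt_prime_le {p : ℕ} (hp : p.Prime) (hγ : 0 < gamma a b p) {c : ℤ}
    (hc : IsCoprime c (p : ℤ)) : ‖sInt a b c p‖ ≤ ratio a b p := by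
  rw [ratio_eq a b hp hγ, sInt, norm_div, Complex.norm_natCast]
  gcongr
  have hcomp : sNum a b c p + ∑ n ∈ roots a b p, e p (c * n) = 0 := by
    have hnd : ¬ (p : ℤ) ∣ c := fun h =>
      (Nat.prime_iff_prime_int.1 hp).not_isUnit (hc.isUnit_of_dvd' h dvd_rfl)
    have := sum_e_mul hp.pos c
    rw [if_neg hnd] at this
    rw [← this, sNum, X, roots, add_comm,
      ← sum_filter_add_sum_filter_not (range p) (fun n : ℕ => (p : ℤ) ∣ F a b (n : ℤ))]
    congr 1
    exact sum_congr (filter_congr fun n _ => gcd_eq_one_iff_not_dvd hp _) fun _ _ => rfl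
  rw [eq_neg_of_add_eq_zero_left hcomp, norm_neg]
  refine (norm_sum_le _ _).trans ?_
  simp [norm_e]

lemma norm_sInt_le (hγ : ∀ m : ℕ, 1 ≤ m → 0 < gamma a b m) {m : ℕ} (hm : 0 < m) {c : ℤ}
    (hc : IsCoprime c (m : ℤ)) : ‖sInt a b c m‖ ≤ ∏ p ∈ m.primeFactors, ratio a b p := by
  induction m using Nat.recOnPosPrimePosCoprime generalizing c with
  | prime_pow p j hp hj =>
    rw [Nat.primeFactors_prime_pow hj.ne' hp, prod_singleton]
    push_cast at hc
    have hc' : IsCoprime c (p : ℤ) := (IsCoprime.pow_right_iff hj).1 hc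
    rcases Nat.lt_or_ge j 2 with h | h
    · obtain rfl : j = 1 := by omega
      rw [pow_one]
      exact norm_sInt_prime_le a b hp (hγ p hp.one_le) hc'
    · rw [sInt_prime_pow_eq_zero a b hp h hc', norm_zero]
      exact ratio_nonneg a b hp (hγ p hp.one_le)
  | zero => exact absurd hm (lt_irrefl _)
  | one =>
    simp only [Nat.primeFactors_one, prod_empty]
    rw [sInt, norm_div, Complex.norm_natCast]
    refine div_le_one_of_le₀ ?_ (by positivity)
    rw [sNum]
    refine (norm_sum_le _ _).trans ?_
    simp [norm_e]
  | coprime x y hx hy hxy ihx ihy =>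
    obtain ⟨u, v, huv⟩ := (Nat.isCoprime_iff_coprime.2 hxy).symm
    have hu : IsCoprime u (x : ℤ) := ⟨y, v, by linarith⟩
    have hv : IsCoprime v (y : ℤ) := ⟨x, u, by linarith⟩
    push_cast at hc
    obtain ⟨hcx, hcy⟩ := IsCoprime.mul_right_iff.1 hc
    rw [sInt_mul a b (by omega) (by omega) hxy huv, norm_mul, hxy.primeFactors_mul,
      prod_union hxy.disjoint_primeFactors]
    exact mul_le_mul (ihx (by omega) (hcx.mul_left hu)) (ihy (by omega) (hcy.mul_left hv))
      (norm_nonneg _) (prod_nonneg fun p hp => ratio_nonneg a b (Nat.prime_of_mem_primeFactors hp)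
        (hγ p (Nat.prime_of_mem_primeFactors hp).one_le))

lemma alphaPart_eq_psiProd (hγ : ∀ m : ℕ, 1 ≤ m → 0 < gamma a b m) {m : ℕ} (hm : 0 < m)
    (n : ℤ) : alphaPart a b m n = if Squarefree m then (psiProd a b m n : ℂ) else 0 := by
  induction m using Nat.recOnPosPrimePosCoprime with
  | prime_pow p j hp hj =>
    rcases Nat.lt_or_ge j 2 with h | h
    · obtain rfl : j = 1 := by omega
      rw [pow_one, if_pos hp.squarefree, alphaPart_prime a b hp (hγ p hp.one_le), psiProd,
        hp.primeFactors, prod_singleton]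
    · rw [if_neg, alphaPart_eq]
      · refine sum_eq_zero fun c _ => ?_
        split_ifs with hc
        · rw [← Int.isCoprime_iff_gcd_eq_one] at hc
          push_cast at hc
          rw [sInt_prime_pow_eq_zero a b hp h ((IsCoprime.pow_right_iff hj).1 hc), zero_mul]
        · rfl
      · intro hsq
        rw [Nat.squarefree_pow_iff hp.ne_one hj.ne'] at hsq
        omega
  | zero => exact absurd hm (lt_irrefl _)
  | one =>
    have hX := card_X_pos a b one_pos (hγ 1 le_rfl)
    have hXC : ((X a b 1).card : ℂ) ≠ 0 := by exact_mod_cast hX.ne'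
    simp [alphaPart_eq, psiProd, sInt, sNum_zero, e_zero, hXC]
  | coprime x y hx hy hxy ihx ihy =>
    rw [alphaPart_mul a b (by omega) (by omega) hxy, ihx (by omega), ihy (by omega),
      psiProd, psiProd, psiProd, hxy.primeFactors_mul, prod_union hxy.disjoint_primeFactors]
    by_cases h1 : Squarefree x <;> by_cases h2 : Squarefree y <;>
      simp [Nat.squarefree_mul hxy, h1, h2]

lemma alpha_eq (hγ : ∀ m : ℕ, 1 ≤ m → 0 < gamma a b m) (R : ℕ) (n : ℤ) :
    alpha a b R n = ((∑ m ∈ Icc 1 R with Squarefree m, psiProd a b m n : ℝ) : ℂ) := by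
  rw [sum_filter]
  push_cast
  refine sum_congr rfl fun m hm => ?_
  refine (alphaPart_eq_psiProd a b hγ (mem_Icc.1 hm).1 n).trans ?_
  split_ifs <;> simp

lemma G_eq (R : ℕ) :
    G a b R = ∑ m ∈ Icc 1 R with Squarefree m, ∏ p ∈ m.primeFactors, ratio a b p := by
  rw [sum_filter, G]
  refine sum_congr rfl fun m _ => ?_
  rw [h]
  split_ifs with hsq
  · rw [ArithmeticFunction.moebius_apply_of_squarefree hsq]
    simp only [ratio]
    push_cast
    rw [← pow_mul, mul_comm _ 2, pow_mul]
    simp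
  · rw [ArithmeticFunction.moebius_eq_zero_of_not_squarefree hsq]
    simp

lemma one_le_G (hγ : ∀ m : ℕ, 1 ≤ m → 0 < gamma a b m) {R : ℕ} (hR : 1 ≤ R) :
    1 ≤ G a b R := by
  rw [G_eq]
  have h1 : 1 ∈ (Icc 1 R).filter Squarefree := by simp [hR]
  refine le_trans ?_ (single_le_sum (fun m _ => prod_nonneg fun p hp =>
    ratio_nonneg a b (Nat.prime_of_mem_primeFactors hp)
      (hγ p (Nat.prime_of_mem_primeFactors hp).one_le)) h1)
  simp

/-! ### Majorants for the sieve components -/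

lemma prod_ratio_le (hγ : ∀ m : ℕ, 1 ≤ m → 0 < gamma a b m) {m : ℕ} (hm : Squarefree m) :
    ∏ p ∈ m.primeFactors, ratio a b p ≤ (k * (k + 1) : ℝ) ^ m.primeFactors.card / m := by
  calc ∏ p ∈ m.primeFactors, ratio a b p
      ≤ ∏ p ∈ m.primeFactors, ((k * (k + 1) : ℝ) / p) :=
        prod_le_prod (fun p hp => ratio_nonneg a b (Nat.prime_of_mem_primeFactors hp)
          (hγ p (Nat.prime_of_mem_primeFactors hp).one_le))
          fun p hp => ratio_le a b (Nat.prime_of_mem_primeFactors hp)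
          (hγ p (Nat.prime_of_mem_primeFactors hp).one_le)
    _ = _ := by
      rw [prod_div_distrib, prod_const, ← Nat.cast_prod, Nat.prod_primeFactors_of_squarefree hm]

lemma gcd_eq_prod {m : ℕ} (hm : Squarefree m) (v : ℤ) :
    Int.gcd (m : ℤ) v = ∏ p ∈ m.primeFactors, if (p : ℤ) ∣ v then p else 1 := by
  rw [prod_ite, prod_const_one, mul_one, Int.gcd, Int.natAbs_natCast]
  have hsq : Squarefree (m.gcd v.natAbs) := hm.squarefree_of_dvd (Nat.gcd_dvd_left _ _)
  rw [← Nat.prod_primeFactors_of_squarefree hsq]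
  refine prod_congr ?_ fun _ _ => rfl
  ext p
  rw [Nat.mem_primeFactors, mem_filter, Nat.mem_primeFactors, Nat.dvd_gcd_iff,
    Int.natCast_dvd]
  have := hsq.ne_zero
  have := hm.ne_zero
  tauto

/-- At each prime both values of `ψ_p` are at most `k(k+1) gcd(p, F(n))/p` in size. This trades the
sign pattern for a divisor sum in `F(n)`. -/
lemma abs_psiProd_le (hk : 1 ≤ k) (hγ : ∀ m : ℕ, 1 ≤ m → 0 < gamma a b m) {m : ℕ}
    (hm : Squarefree m) (n : ℤ) :
    |psiProd a b m n| ≤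
      (k * (k + 1) : ℝ) ^ m.primeFactors.card * (Int.gcd (m : ℤ) (F a b n) / m) := by
  have hk' : (1 : ℝ) ≤ k := by exact_mod_cast hk
  rw [psiProd, abs_prod]
  calc ∏ p ∈ m.primeFactors, |psi a b p n|
      ≤ ∏ p ∈ m.primeFactors,
          ((k * (k + 1) : ℝ) * (((if (p : ℤ) ∣ F a b n then p else 1 : ℕ) : ℝ) / p)) := by
        refine prod_le_prod (fun p _ => abs_nonneg _) fun p hp => ?_
        have hpp := Nat.prime_of_mem_primeFactors hp
        have hp0 : (p : ℝ) ≠ 0 := by exact_mod_cast hpp.ne_zero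
        unfold psi
        split_ifs
        · rw [abs_neg, abs_one, div_self hp0]
          nlinarith
        · rw [abs_of_nonneg (ratio_nonneg a b hpp (hγ p hpp.one_le))]
          refine (ratio_le a b hpp (hγ p hpp.one_le)).trans (le_of_eq ?_)
          simp [div_eq_mul_inv]
    _ = _ := by
      rw [prod_mul_distrib, prod_const, prod_div_distrib, gcd_eq_prod hm, ← Nat.cast_prod,
        ← Nat.cast_prod, Nat.prod_primeFactors_of_squarefree hm]

end

section

/-! ### Divisor bounds -/

lemma exists_pow_card_primeFactors_le {C ε : ℝ} (hC : 1 ≤ C) (hε : 0 < ε) :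
    ∃ K : ℝ, 1 ≤ K ∧ ∀ m : ℕ, m ≠ 0 → C ^ m.primeFactors.card ≤ K * (m : ℝ) ^ ε := by
  -- A prime `p ≥ P` satisfies `C ≤ p^ε`; the fewer than `P + 1` smaller primes cost at most `C^P`
  -- in total.
  obtain ⟨P, hP⟩ := exists_nat_ge (C ^ (1 / ε))
  refine ⟨C ^ P, one_le_pow₀ hC, fun m hm => ?_⟩
  have hlarge : ∀ p : ℕ, P ≤ p → C ≤ (p : ℝ) ^ ε := by
    intro p hp
    have h1 : C ^ (1 / ε) ≤ p := hP.trans (by exact_mod_cast hp)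
    calc C = (C ^ (1 / ε)) ^ ε := by
          rw [← Real.rpow_mul (by linarith), one_div_mul_cancel hε.ne', Real.rpow_one]
      _ ≤ _ := Real.rpow_le_rpow (by positivity) h1 hε.le
  calc C ^ m.primeFactors.card = ∏ _p ∈ m.primeFactors, C := by rw [prod_const]
    _ ≤ ∏ p ∈ m.primeFactors, ((if p < P then C else 1) * (p : ℝ) ^ ε) := by
      refine prod_le_prod (fun _ _ => by linarith) fun p hp => ?_
      have h1 : (1 : ℝ) ≤ (p : ℝ) ^ ε :=
        Real.one_le_rpow (by exact_mod_cast (Nat.prime_of_mem_primeFactors hp).one_le) hε.le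
      split_ifs with h
      · nlinarith
      · rw [one_mul]
        exact hlarge p (by omega)
    _ ≤ C ^ P * (m : ℝ) ^ ε := by
      rw [prod_mul_distrib]
      refine mul_le_mul ?_ ?_ (by positivity) (by positivity)
      · rw [prod_ite, prod_const_one, mul_one, prod_const]
        refine pow_le_pow_right₀ hC ?_
        calc _ ≤ (range P).card := card_le_card fun p hp => by
              simpa using (mem_filter.1 hp).2
          _ = P := card_range P
      · rw [Real.finsetProd_rpow _ _ (fun _ _ => by positivity)]
        refine Real.rpow_le_rpow (by positivity) ?_ hε.le
        rw [← Nat.cast_prod]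
        exact_mod_cast Nat.le_of_dvd (Nat.pos_of_ne_zero hm) (Nat.prod_primeFactors_dvd m)

/-- The square-free divisors of `v` that are at most `Q`. -/
def sqfDivisors (Q : ℕ) (v : ℤ) : Finset ℕ :=
  (Icc 1 Q).filter fun d => Squarefree d ∧ (d : ℤ) ∣ v

lemma sum_inv_le {δ : ℝ} (hδ : 0 < δ) {Q : ℕ} (hQ : 1 ≤ Q) :
    ∑ d ∈ Icc 1 Q, (1 : ℝ) / d ≤ (1 + 1 / δ) * (Q : ℝ) ^ δ := by
  have h1 := harmonic_le_one_add_log Q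
  have h2 : ((harmonic Q : ℚ) : ℝ) = ∑ d ∈ Icc 1 Q, (1 : ℝ) / d := by
    rw [harmonic_eq_sum_Icc]
    push_cast
    simp
  have hQ' : (1 : ℝ) ≤ Q := by exact_mod_cast hQ
  have h3 := Real.log_le_rpow_div (show (0 : ℝ) ≤ Q by linarith) hδ
  have h4 : 1 ≤ (Q : ℝ) ^ δ := Real.one_le_rpow hQ' hδ.le
  rw [← h2]
  calc _ ≤ (1 : ℝ) + Real.log Q := h1
    _ ≤ (Q : ℝ) ^ δ + (Q : ℝ) ^ δ / δ := by linarith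
    _ = _ := by ring

/-- Writing `m = g m'` with `g = gcd(m, v)` turns `gcd(m, v)/m` into `1/m'`. Thus each square-free
divisor `g ≤ Q` of `v` contributes at most a harmonic sum, and the factor `C^ω(m)` is absorbed in a
power of `Q`. -/
lemma exists_sum_gcd_le {C δ : ℝ} (hC : 1 ≤ C) (hδ : 0 < δ) :
    ∃ K : ℝ, 0 < K ∧ ∀ (Q : ℕ) (v : ℤ), 1 ≤ Q →
      ∑ m ∈ Icc 1 Q with Squarefree m, C ^ m.primeFactors.card * (Int.gcd (m : ℤ) v / m : ℝ) ≤
        K * (Q : ℝ) ^ δ * (sqfDivisors Q v).card := by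
  obtain ⟨K, hK, hKm⟩ := exists_pow_card_primeFactors_le hC (half_pos hδ)
  refine ⟨K * (1 + 1 / (δ / 2)), by positivity, fun Q v hQ => ?_⟩
  have hQ' : (0 : ℝ) < Q := by exact_mod_cast hQ
  have hred : ∑ m ∈ Icc 1 Q with Squarefree m, (Int.gcd (m : ℤ) v / m : ℝ) ≤
      (sqfDivisors Q v).card * ∑ d ∈ Icc 1 Q, (1 : ℝ) / d := by
    set A := (Icc 1 Q).filter fun m : ℕ => Squarefree m with hA
    let ι : ℕ → ℕ × ℕ := fun m => (Int.gcd (m : ℤ) v, m / Int.gcd (m : ℤ) v)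
    have hgd : ∀ m : ℕ, Int.gcd (m : ℤ) v ∣ m := fun m => by
      have := Int.gcd_dvd_left (m : ℤ) v
      exact_mod_cast this
    have hinj : Set.InjOn ι A := by
      intro x _ y _ hxy
      simp only [ι, Prod.mk.injEq] at hxy
      rw [← Nat.mul_div_cancel' (hgd x), ← Nat.mul_div_cancel' (hgd y), hxy.2, hxy.1]
    calc ∑ m ∈ A, (Int.gcd (m : ℤ) v / m : ℝ)
        = ∑ m ∈ A, (1 : ℝ) / (ι m).2 := by
          refine sum_congr rfl fun m hm => ?_
          have hm0 : 0 < m := (mem_Icc.1 (mem_filter.1 hm).1).1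
          have hg0 : 0 < Int.gcd (m : ℤ) v := Nat.pos_of_dvd_of_pos (hgd m) hm0
          have hg0' : (Int.gcd (m : ℤ) v : ℝ) ≠ 0 := by exact_mod_cast hg0.ne'
          simp only [ι]
          rw [Nat.cast_div (hgd m) hg0', one_div_div]
      _ = ∑ x ∈ A.image ι, (1 : ℝ) / x.2 := 
          (sum_image (f := fun x : ℕ × ℕ => (1 : ℝ) / x.2) hinj).symm
      _ ≤ ∑ x ∈ sqfDivisors Q v ×ˢ Icc 1 Q, (1 : ℝ) / x.2 := by
          refine sum_le_sum_of_subset_of_nonneg ?_ fun _ _ _ => by positivity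
          intro x hx
          obtain ⟨m, hm, rfl⟩ := mem_image.1 hx
          rw [hA, mem_filter, mem_Icc] at hm
          have hg0 : 0 < Int.gcd (m : ℤ) v := Nat.pos_of_dvd_of_pos (hgd m) hm.1.1
          simp only [ι, mem_product, sqfDivisors, mem_filter, mem_Icc]
          refine ⟨⟨⟨hg0, (Nat.le_of_dvd hm.1.1 (hgd m)).trans hm.1.2⟩,
            hm.2.squarefree_of_dvd (hgd m), Int.gcd_dvd_right _ _⟩, ?_,
            (Nat.div_le_self _ _).trans hm.1.2⟩
          exact Nat.div_pos (Nat.le_of_dvd hm.1.1 (hgd m)) hg0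
      _ = _ := by
          rw [sum_product]
          simp
  calc ∑ m ∈ Icc 1 Q with Squarefree m, C ^ m.primeFactors.card * (Int.gcd (m : ℤ) v / m : ℝ)
      ≤ ∑ m ∈ Icc 1 Q with Squarefree m, K * (Q : ℝ) ^ (δ / 2) * (Int.gcd (m : ℤ) v / m : ℝ) := by
        refine sum_le_sum fun m hm => ?_
        rw [mem_filter, mem_Icc] at hm
        have h1 : (m : ℝ) ^ (δ / 2) ≤ (Q : ℝ) ^ (δ / 2) :=
          Real.rpow_le_rpow (by positivity) (by exact_mod_cast hm.1.2) (by positivity)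
        have h2 := hKm m (by omega)
        gcongr
        exact h2.trans (by gcongr)
    _ = K * (Q : ℝ) ^ (δ / 2) * ∑ m ∈ Icc 1 Q with Squarefree m, (Int.gcd (m : ℤ) v / m : ℝ) := by
        rw [mul_sum]
    _ ≤ K * (Q : ℝ) ^ (δ / 2) * ((sqfDivisors Q v).card *
          ((1 + 1 / (δ / 2)) * (Q : ℝ) ^ (δ / 2))) := by
        gcongr
        exact hred.trans (by gcongr; exact sum_inv_le (half_pos hδ) hQ)
    _ = K * (1 + 1 / (δ / 2)) * ((Q : ℝ) ^ (δ / 2) * (Q : ℝ) ^ (δ / 2)) *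
          (sqfDivisors Q v).card := by ring
    _ = _ := by rw [← Real.rpow_add hQ', add_halves]

lemma squarefree_lcm {m n : ℕ} (hm : Squarefree m) (hn : Squarefree n) :
    Squarefree (m.lcm n) := by
  have hm0 := hm.ne_zero
  have hn0 := hn.ne_zero
  rw [Nat.squarefree_iff_factorization_le_one (Nat.lcm_ne_zero hm0 hn0)]
  intro p
  rw [Nat.factorization_lcm hm0 hn0]
  exact sup_le ((Nat.squarefree_iff_factorization_le_one hm0).1 hm p)
    ((Nat.squarefree_iff_factorization_le_one hn0).1 hn p)

/-- A pair of divisors is sent to its least common multiple, a square-free divisor of `v` up to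
`QQ'`. The fibre over `L` has at most `3^ω(L)` elements: each prime of `L` divides the first, the
second or both. -/
lemma exists_card_sqfDivisors_mul_le {δ : ℝ} (hδ : 0 < δ) :
    ∃ K : ℝ, 0 < K ∧ ∀ (Q Q' : ℕ) (v : ℤ), 1 ≤ Q → 1 ≤ Q' →
      ((sqfDivisors Q v).card : ℝ) * (sqfDivisors Q' v).card ≤
        K * ((Q * Q' : ℕ) : ℝ) ^ δ * (sqfDivisors (Q * Q') v).card := by
  obtain ⟨K, hK, hKm⟩ := exists_pow_card_primeFactors_le (show (1 : ℝ) ≤ 3 by norm_num) hδ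
  refine ⟨K, by positivity, fun Q Q' v hQ hQ' => ?_⟩
  have hmaps : Set.MapsTo (fun x : ℕ × ℕ => x.1.lcm x.2)
      (sqfDivisors Q v ×ˢ sqfDivisors Q' v : Finset (ℕ × ℕ)) (sqfDivisors (Q * Q') v) := by
    rintro ⟨x, y⟩ hxy
    simp only [coe_product, Set.mem_prod, mem_coe, sqfDivisors, mem_filter, mem_Icc] at hxy ⊢
    obtain ⟨⟨⟨hx1, hx2⟩, hx3, hx4⟩, ⟨hy1, hy2⟩, hy3, hy4⟩ := hxy
    refine ⟨⟨Nat.lcm_pos hx1 hy1, ?_⟩, squarefree_lcm hx3 hy3, ?_⟩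
    · exact (Nat.le_of_dvd (Nat.mul_pos hx1 hy1) (Nat.lcm_dvd_mul x y)).trans
        (Nat.mul_le_mul hx2 hy2)
    · rw [Int.natCast_dvd] at hx4 hy4 ⊢
      exact Nat.lcm_dvd hx4 hy4
  have h1 := card_eq_sum_card_fiberwise hmaps
  rw [card_product] at h1
  have h2 : ((sqfDivisors Q v).card : ℝ) * (sqfDivisors Q' v).card =
      ∑ L ∈ sqfDivisors (Q * Q') v, ((((sqfDivisors Q v ×ˢ sqfDivisors Q' v).filter
        fun x => x.1.lcm x.2 = L).card : ℕ) : ℝ) := by exact_mod_cast h1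
  rw [h2]
  calc _ ≤ ∑ L ∈ sqfDivisors (Q * Q') v, K * ((Q * Q' : ℕ) : ℝ) ^ δ := by
        refine sum_le_sum fun L hL => ?_
        rw [sqfDivisors, mem_filter, mem_Icc] at hL
        have hL0 : L ≠ 0 := by omega
        have h3 : (((sqfDivisors Q v ×ˢ sqfDivisors Q' v).filter
            fun x => x.1.lcm x.2 = L).card) ≤ 3 ^ L.primeFactors.card := by
          have hω : ArithmeticFunction.cardDistinctFactors L = L.primeFactors.card := by
            rw [ArithmeticFunction.cardDistinctFactors_apply, Nat.primeFactors, List.card_toFinset]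
          rw [← hω, ← Nat.card_pair_lcm_eq hL.2.1]
          refine card_le_card fun x hx => ?_
          rw [mem_filter] at hx ⊢
          refine ⟨?_, hx.2⟩
          rw [mem_product, Nat.mem_divisors, Nat.mem_divisors, ← hx.2]
          exact ⟨⟨Nat.dvd_lcm_left _ _, hx.2 ▸ hL0⟩, Nat.dvd_lcm_right _ _, hx.2 ▸ hL0⟩
        calc _ ≤ (3 : ℝ) ^ L.primeFactors.card := by exact_mod_cast h3
          _ ≤ K * (L : ℝ) ^ δ := hKm L hL0
          _ ≤ _ := by
            have : (L : ℝ) ≤ (Q * Q' : ℕ) := by exact_mod_cast hL.1.2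
            gcongr
    _ = _ := by
        rw [sum_const, nsmul_eq_mul, mul_comm]

lemma one_le_card_sqfDivisors {Q : ℕ} (hQ : 1 ≤ Q) (v : ℤ) : 1 ≤ (sqfDivisors Q v).card := by
  rw [Nat.one_le_iff_ne_zero, ← pos_iff_ne_zero, card_pos]
  exact ⟨1, by simp [sqfDivisors, hQ]⟩

lemma exists_card_sqfDivisors_pow_le (t : ℕ) {δ : ℝ} (hδ : 0 < δ) :
    ∃ K : ℝ, 0 < K ∧ ∀ (Q : ℕ) (v : ℤ), 1 ≤ Q →
      ((sqfDivisors Q v).card : ℝ) ^ t ≤ K * (Q : ℝ) ^ δ * (sqfDivisors (Q ^ t) v).card := by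
  induction t generalizing δ with
  | zero =>
    refine ⟨1, one_pos, fun Q v hQ => ?_⟩
    have h1 : (1 : ℝ) ≤ (Q : ℝ) ^ δ := Real.one_le_rpow (by exact_mod_cast hQ) hδ.le
    have h2 : (1 : ℝ) ≤ (sqfDivisors (Q ^ 0) v).card := by
      exact_mod_cast one_le_card_sqfDivisors (by simp) v
    rw [pow_zero, one_mul]
    nlinarith
  | succ t ih =>
    obtain ⟨K, hK, h⟩ := ih (half_pos hδ)
    have ht : (0 : ℝ) < (t + 1 : ℕ) := by positivity
    -- The exponent is divided by `t + 1` because it is applied to `Q^(t+1)`.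
    obtain ⟨K', hK', h'⟩ := exists_card_sqfDivisors_mul_le
      (show 0 < δ / 2 / (t + 1 : ℕ) by positivity)
    refine ⟨K * K', by positivity, fun Q v hQ => ?_⟩
    have hQ0 : (0 : ℝ) < Q := by exact_mod_cast hQ
    rw [pow_succ]
    calc ((sqfDivisors Q v).card : ℝ) ^ t * (sqfDivisors Q v).card
        ≤ K * (Q : ℝ) ^ (δ / 2) * (sqfDivisors (Q ^ t) v).card * (sqfDivisors Q v).card := by
          gcongr
          exact h Q v hQ
      _ = K * (Q : ℝ) ^ (δ / 2) * ((sqfDivisors (Q ^ t) v).card * (sqfDivisors Q v).card) := by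
          ring
      _ ≤ K * (Q : ℝ) ^ (δ / 2) * (K' * ((Q ^ t * Q : ℕ) : ℝ) ^ (δ / 2 / (t + 1 : ℕ)) *
            (sqfDivisors (Q ^ t * Q) v).card) := by
          refine mul_le_mul_of_nonneg_left ?_ (by positivity)
          exact h' _ _ v (Nat.one_le_pow _ _ hQ) hQ
      _ = K * (Q : ℝ) ^ (δ / 2) * (K' * (Q : ℝ) ^ (δ / 2) * (sqfDivisors (Q ^ (t + 1)) v).card) := by
          rw [← pow_succ]
          congr 3
          push_cast
          rw [← Real.rpow_natCast, ← Real.rpow_mul hQ0.le]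
          congr 1
          push_cast
          field_simp
      _ = K * K' * ((Q : ℝ) ^ (δ / 2) * (Q : ℝ) ^ (δ / 2)) *
            (sqfDivisors (Q ^ (t + 1)) v).card := by ring
      _ = _ := by rw [← Real.rpow_add hQ0, add_halves]

lemma exists_card_sqfDivisors_le {δ : ℝ} (hδ : 0 < δ) :
    ∃ K : ℝ, 0 < K ∧ ∀ (Q : ℕ) (v : ℤ), v ≠ 0 →
      ((sqfDivisors Q v).card : ℝ) ≤ K * (|v| : ℝ) ^ δ := by
  obtain ⟨K, hK, hKm⟩ := exists_pow_card_primeFactors_le (show (1 : ℝ) ≤ 2 by norm_num) hδ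
  refine ⟨K, by positivity, fun Q v hv => ?_⟩
  have hv0 : v.natAbs ≠ 0 := Int.natAbs_ne_zero.2 hv
  have h1 : (sqfDivisors Q v).card ≤ 2 ^ v.natAbs.primeFactors.card := by
    rw [← card_powerset]
    refine card_le_card_of_injOn Nat.primeFactors ?_ ?_
    · intro d hd
      simp only [mem_coe, sqfDivisors, mem_filter, Int.natCast_dvd] at hd
      rw [mem_coe, mem_powerset]
      exact Nat.primeFactors_mono hd.2.2 hv0
    · intro x hx y hy hxy
      simp only [mem_coe, sqfDivisors, mem_filter] at hx hy
      rw [← Nat.prod_primeFactors_of_squarefree hx.2.1,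
        ← Nat.prod_primeFactors_of_squarefree hy.2.1, hxy]
  calc ((sqfDivisors Q v).card : ℝ) ≤ (2 : ℝ) ^ v.natAbs.primeFactors.card := by exact_mod_cast h1
    _ ≤ K * (v.natAbs : ℝ) ^ δ := hKm _ hv0
    _ = _ := by rw [Nat.cast_natAbs, Int.cast_abs]

/-! ### Divisors of the values of `F` -/

variable {k : ℕ}

/-- A root modulo a square-free `d` is determined by its reductions modulo the primes of `d`, which
are roots there. -/
lemma card_roots_squarefree_le (a b : Fin k → ℤ) (hγ : ∀ m : ℕ, 1 ≤ m → 0 < gamma a b m) {d : ℕ}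
    (hd : Squarefree d) : (roots a b d).card ≤ k ^ d.primeFactors.card := by
  have h1 : (roots a b d).card ≤ (d.primeFactors.pi fun p => roots a b p).card := by
    refine card_le_card_of_injOn (fun n p _ => n % p) ?_ ?_
    · intro n hn
      simp only [mem_coe, roots, mem_filter] at hn
      simp only [mem_coe, mem_pi, roots, mem_filter, mem_range]
      intro p hp
      refine ⟨Nat.mod_lt _ (Nat.prime_of_mem_primeFactors hp).pos, ?_⟩
      have h2 : (p : ℤ) ∣ F a b n :=
        (Int.natCast_dvd_natCast.2 (Nat.dvd_of_mem_primeFactors hp)).trans hn.2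
      have h3 : F a b ((n % p : ℕ) : ℤ) ≡ F a b n [ZMOD p] := F_modEq a b (by
        push_cast
        exact Int.mod_modEq _ _)
      exact h3.dvd_iff.2 h2
    · intro x hx y hy hxy
      simp only [mem_coe, roots, mem_filter, mem_range] at hx hy
      have h2 : (d : ℤ) ∣ (y : ℤ) - x := by
        rw [Int.natCast_dvd, ← Nat.prod_primeFactors_of_squarefree hd]
        refine prod_primes_dvd _ (fun p hp => (Nat.prime_of_mem_primeFactors hp).prime) ?_
        intro p hp
        rw [← Int.natCast_dvd]
        have := congrFun (congrFun hxy p) hp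
        exact (Int.natCast_modEq_iff.2 (show x ≡ y [MOD p] from this)).dvd
      exact Nat.ModEq.eq_of_lt_of_lt (Int.natCast_modEq_iff.1 (Int.modEq_iff_dvd.2 h2)) hx.1 hy.1
  refine h1.trans ?_
  rw [card_pi]
  exact prod_le_pow_card _ _ _ fun p hp => card_roots_le a b (Nat.prime_of_mem_primeFactors hp)
    (hγ p (Nat.prime_of_mem_primeFactors hp).one_le)

lemma card_dvd_F_le (a b : Fin k → ℤ) (hγ : ∀ m : ℕ, 1 ≤ m → 0 < gamma a b m) {d N : ℕ}
    (hd : Squarefree d) (hdN : d ≤ N) :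
    (((Icc 1 N).filter fun n : ℕ => (d : ℤ) ∣ F a b n).card : ℝ) ≤
      (k : ℝ) ^ d.primeFactors.card * (2 * N / d) := by
  have hd0 : 0 < d := Nat.pos_of_ne_zero hd.ne_zero
  have h1 : ((Icc 1 N).filter fun n : ℕ => (d : ℤ) ∣ F a b n).card ≤
      (roots a b d ×ˢ range (N / d + 1)).card := by
    refine card_le_card_of_injOn (fun n => (n % d, n / d)) ?_ ?_
    · intro n hn
      simp only [mem_coe, mem_filter, mem_Icc] at hn
      simp only [mem_coe, mem_product, roots, mem_filter, mem_range]
      refine ⟨⟨Nat.mod_lt _ hd0, ?_⟩, Nat.lt_succ_of_le (Nat.div_le_div_right hn.1.2)⟩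
      have h3 : F a b ((n % d : ℕ) : ℤ) ≡ F a b n [ZMOD d] := F_modEq a b (by
        push_cast
        exact Int.mod_modEq _ _)
      exact h3.dvd_iff.2 hn.2
    · intro x _ y _ hxy
      simp only [Prod.mk.injEq] at hxy
      rw [← Nat.mod_add_div x d, ← Nat.mod_add_div y d, hxy.1, hxy.2]
  rw [card_product, card_range] at h1
  have h2 := card_roots_squarefree_le a b hγ hd
  -- The incomplete block of length `d` is absorbed because `d ≤ N`.
  have h3 : ((N / d : ℕ) : ℝ) + 1 ≤ 2 * N / d := by
    have h4 : ((N / d : ℕ) : ℝ) ≤ N / d := Nat.cast_div_le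
    have h5 : (1 : ℝ) ≤ N / d := by
      rw [one_le_div (by exact_mod_cast hd0)]
      exact_mod_cast hdN
    calc _ ≤ (N / d : ℝ) + N / d := by linarith
      _ = _ := by ring
  calc (((Icc 1 N).filter fun n : ℕ => (d : ℤ) ∣ F a b n).card : ℝ)
      ≤ ((roots a b d).card : ℝ) * ((N / d : ℕ) + 1) := by exact_mod_cast h1
    _ ≤ (k : ℝ) ^ d.primeFactors.card * (2 * N / d) := by
      refine mul_le_mul (by exact_mod_cast h2) h3 (by positivity) (by positivity)

lemma exists_sum_card_sqfDivisors_F_le (hk : 1 ≤ k) {δ : ℝ} (hδ : 0 < δ) :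
    ∃ K : ℝ, 0 < K ∧ ∀ (N L : ℕ) (a b : Fin k → ℤ), (∀ m : ℕ, 1 ≤ m → 0 < gamma a b m) →
      1 ≤ L → L ≤ N →
      ∑ n ∈ Icc 1 N, ((sqfDivisors L (F a b n)).card : ℝ) ≤ K * N * (L : ℝ) ^ δ := by
  obtain ⟨K, hK, hKm⟩ := exists_pow_card_primeFactors_le
    (show (1 : ℝ) ≤ k by exact_mod_cast hk) (half_pos hδ)
  refine ⟨2 * K * (1 + 1 / (δ / 2)), by positivity, fun N L a b hγ hL hLN => ?_⟩
  have hL0 : (0 : ℝ) < L := by exact_mod_cast hL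
  have h1 : ∑ n ∈ Icc 1 N, ((sqfDivisors L (F a b n)).card : ℝ) =
      ∑ d ∈ Icc 1 L with Squarefree d,
        (((Icc 1 N).filter fun n : ℕ => (d : ℤ) ∣ F a b n).card : ℝ) := by
    simp only [sqfDivisors, ← filter_filter, card_filter _ (filter _ _), card_filter _ (Icc 1 N)]
    push_cast
    rw [sum_comm]
  rw [h1]
  calc _ ≤ ∑ d ∈ Icc 1 L with Squarefree d, 2 * K * N * (L : ℝ) ^ (δ / 2) * (1 / d) := by
        refine sum_le_sum fun d hd => ?_
        rw [mem_filter, mem_Icc] at hd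
        refine (card_dvd_F_le a b hγ hd.2 (hd.1.2.trans hLN)).trans ?_
        have h2 := hKm d (by omega)
        have h3 : (d : ℝ) ^ (δ / 2) ≤ (L : ℝ) ^ (δ / 2) :=
          Real.rpow_le_rpow (by positivity) (by exact_mod_cast hd.1.2) (by positivity)
        calc (k : ℝ) ^ d.primeFactors.card * (2 * N / d)
            ≤ (K * (L : ℝ) ^ (δ / 2)) * (2 * N / d) := by
              gcongr
              exact h2.trans (by gcongr)
          _ = _ := by ring
    _ ≤ ∑ d ∈ Icc 1 L, 2 * K * N * (L : ℝ) ^ (δ / 2) * (1 / d) :=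
        sum_le_sum_of_subset_of_nonneg (filter_subset _ _) fun _ _ _ => by positivity
    _ = 2 * K * N * (L : ℝ) ^ (δ / 2) * ∑ d ∈ Icc 1 L, (1 : ℝ) / d := by rw [mul_sum]
    _ ≤ 2 * K * N * (L : ℝ) ^ (δ / 2) * ((1 + 1 / (δ / 2)) * (L : ℝ) ^ (δ / 2)) := by
        gcongr
        exact sum_inv_le (half_pos hδ) hL
    _ = 2 * K * (1 + 1 / (δ / 2)) * N * ((L : ℝ) ^ (δ / 2) * (L : ℝ) ^ (δ / 2)) := by ring
    _ = _ := by rw [← Real.rpow_add hL0, add_halves]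

/-- The sum is at most `Q^δ` times the number of square-free divisors up to `Q`. The `t`-th power of
that count is controlled by the count up to `Q^t`, which is small on average over `n ≤ N` as long as
`Q^t ≤ N`. -/
lemma exists_moment_le (hk : 1 ≤ k) {C : ℝ} (hC : 1 ≤ C) (t : ℕ) {δ : ℝ} (hδ : 0 < δ) :
    ∃ K : ℝ, 0 < K ∧ ∀ (N Q : ℕ) (a b : Fin k → ℤ), (∀ m : ℕ, 1 ≤ m → 0 < gamma a b m) →
      1 ≤ Q → Q ^ t ≤ N →
      ∑ n ∈ Icc 1 N, (∑ m ∈ Icc 1 Q with Squarefree m,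
        C ^ m.primeFactors.card * (Int.gcd (m : ℤ) (F a b n) / m : ℝ)) ^ t ≤
          K * N * (Q : ℝ) ^ δ := by
  -- Each of three estimates may lose `Q^(δ/3)`. Two of them meet a `t`-th power, so their exponents
  -- are divided by `t + 1`, which is non-zero also for `t = 0`.
  have ht : (0 : ℝ) < (t + 1 : ℕ) := by positivity
  have hδ3 : 0 < δ / 3 := by positivity
  obtain ⟨K₁, hK₁, h₁⟩ := exists_sum_gcd_le hC (show 0 < δ / 3 / (t + 1 : ℕ) by positivity)
  obtain ⟨K₂, hK₂, h₂⟩ := exists_card_sqfDivisors_pow_le t hδ3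
  obtain ⟨K₃, hK₃, h₃⟩ := exists_sum_card_sqfDivisors_F_le hk
    (show 0 < δ / 3 / (t + 1 : ℕ) by positivity)
  refine ⟨K₁ ^ t * K₂ * K₃, by positivity, fun N Q a b hγ hQ hQN => ?_⟩
  have hQ0 : (0 : ℝ) < Q := by exact_mod_cast hQ
  have hQ1 : (1 : ℝ) ≤ Q := by exact_mod_cast hQ
  have hexp : ((Q : ℝ) ^ (δ / 3 / (t + 1 : ℕ))) ^ t ≤ (Q : ℝ) ^ (δ / 3) := by
    rw [← Real.rpow_natCast, ← Real.rpow_mul hQ0.le]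
    refine Real.rpow_le_rpow_of_exponent_le hQ1 ?_
    rw [div_mul_eq_mul_div, div_le_iff₀ ht]
    push_cast
    nlinarith
  calc _ ≤ ∑ n ∈ Icc 1 N, K₁ ^ t * (Q : ℝ) ^ (δ / 3) * (K₂ * (Q : ℝ) ^ (δ / 3) *
          (sqfDivisors (Q ^ t) (F a b n)).card) := by
        refine sum_le_sum fun n _ => ?_
        calc _ ≤ (K₁ * (Q : ℝ) ^ (δ / 3 / (t + 1 : ℕ)) * (sqfDivisors Q (F a b n)).card) ^ t :=
              pow_le_pow_left₀ (sum_nonneg fun _ _ => by positivity) (h₁ Q _ hQ) t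
          _ = K₁ ^ t * ((Q : ℝ) ^ (δ / 3 / (t + 1 : ℕ))) ^ t *
                ((sqfDivisors Q (F a b n)).card : ℝ) ^ t := by rw [mul_pow, mul_pow]
          _ ≤ _ := by
              gcongr
              exact h₂ Q _ hQ
    _ = K₁ ^ t * K₂ * ((Q : ℝ) ^ (δ / 3) * (Q : ℝ) ^ (δ / 3)) *
          ∑ n ∈ Icc 1 N, ((sqfDivisors (Q ^ t) (F a b n)).card : ℝ) := by
        rw [mul_sum]
        exact sum_congr rfl fun _ _ => by ring
    _ ≤ K₁ ^ t * K₂ * ((Q : ℝ) ^ (δ / 3) * (Q : ℝ) ^ (δ / 3)) *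
          (K₃ * N * (Q : ℝ) ^ (δ / 3)) := by
        gcongr
        refine (h₃ N (Q ^ t) a b hγ (Nat.one_le_pow _ _ hQ) hQN).trans ?_
        push_cast
        gcongr
        rw [← Real.rpow_natCast, ← Real.rpow_mul hQ0.le, mul_comm, Real.rpow_mul hQ0.le,
          Real.rpow_natCast]
        exact_mod_cast hexp
    _ = K₁ ^ t * K₂ * K₃ * N *
          ((Q : ℝ) ^ (δ / 3) * (Q : ℝ) ^ (δ / 3) * (Q : ℝ) ^ (δ / 3)) := by ring
    _ = _ := by
        rw [← Real.rpow_add hQ0, ← Real.rpow_add hQ0]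
        congr 2
        ring

end

section

/-! ### Expansion of the enveloping sieve -/

/-- The factors over `S ∩ T` are squares. The quadratic relation linearises each of them, and `E`
records the places where the constant term `r p` is taken. -/
lemma prod_mul_prod_expand {r ψ : ℕ → ℝ} (hψ : ∀ p, ψ p ^ 2 = r p + (r p - 1) * ψ p)
    (S T : Finset ℕ) :
    (∏ p ∈ S, ψ p) * ∏ p ∈ T, ψ p =
      ∑ E ∈ (S ∩ T).powerset, ((∏ p ∈ E, r p) * ∏ p ∈ (S ∩ T) \ E, (r p - 1)) *
        ∏ p ∈ (S ∪ T) \ E, ψ p := by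
  have hsub : S ∩ T ⊆ S ∪ T := inter_subset_left.trans subset_union_left
  have h1 : ∏ p ∈ S ∩ T, ψ p ^ 2 = ∑ E ∈ (S ∩ T).powerset,
      (∏ p ∈ E, r p) * ∏ p ∈ (S ∩ T) \ E, ((r p - 1) * ψ p) := by
    rw [← prod_add]
    exact prod_congr rfl fun p _ => hψ p
  rw [← prod_union_inter, ← prod_sdiff hsub, mul_assoc, ← sq, ← prod_pow, h1, mul_sum]
  refine sum_congr rfl fun E hE => ?_
  rw [mem_powerset] at hE
  have h2 : (S ∪ T) \ E = ((S ∪ T) \ (S ∩ T)) ∪ ((S ∩ T) \ E) := by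
    ext p
    have := @hE p
    have := @hsub p
    simp only [mem_sdiff, mem_union, mem_inter] at *
    tauto
  have h3 : Disjoint ((S ∪ T) \ (S ∩ T)) ((S ∩ T) \ E) :=
    disjoint_sdiff_self_left.mono_right sdiff_subset
  rw [h2, prod_union h3, prod_mul_distrib]
  ring

/-- The coefficient of `U` collects the triples `(S, T, E)` with `(S ∪ T) \ E = U`. Such a triple is
determined by `E` and the subsets `S \ E`, `T \ E` of `U`, so there are at most `4^|U|` of them for
each `E`. The remaining sum over `E` is the full sum of the weights `∏ r p`, which plays the role of
`G(R)`. -/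
lemma exists_sq_sum_expansion (𝒜 𝒰 : Finset (Finset ℕ)) (hdown : ∀ S ∈ 𝒜, ∀ E ⊆ S, E ∈ 𝒜)
    (h𝒰 : ∀ S ∈ 𝒜, ∀ T ∈ 𝒜, ∀ E ⊆ S ∩ T, (S ∪ T) \ E ∈ 𝒰) (r : ℕ → ℝ)
    (hr : ∀ S ∈ 𝒜, ∀ p ∈ S, 0 ≤ r p) {C : ℝ} (hC : 1 ≤ C)
    (hrC : ∀ S ∈ 𝒜, ∀ p ∈ S, |r p - 1| ≤ C) :
    ∃ W : Finset ℕ → ℝ, (∀ U, |W U| ≤ (∑ S ∈ 𝒜, ∏ p ∈ S, r p) * (4 * C) ^ U.card) ∧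
      ∀ ψ : ℕ → ℝ, (∀ p, ψ p ^ 2 = r p + (r p - 1) * ψ p) →
        (∑ S ∈ 𝒜, ∏ p ∈ S, ψ p) ^ 2 = ∑ U ∈ 𝒰, W U * ∏ p ∈ U, ψ p := by
  -- Downward closure allows `E` to range over `𝒜`, independently of `S` and `T`.
  set 𝒯 : Finset (Finset ℕ × Finset ℕ × Finset ℕ) :=
    (𝒜 ×ˢ 𝒜 ×ˢ 𝒜).filter fun t => t.2.2 ⊆ t.1 ∩ t.2.1 with h𝒯
  let w : Finset ℕ × Finset ℕ × Finset ℕ → ℝ := fun t =>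
    (∏ p ∈ t.2.2, r p) * ∏ p ∈ (t.1 ∩ t.2.1) \ t.2.2, (r p - 1)
  let φ : Finset ℕ × Finset ℕ × Finset ℕ → Finset ℕ := fun t => (t.1 ∪ t.2.1) \ t.2.2
  have hmem : ∀ t ∈ 𝒯, t.1 ∈ 𝒜 ∧ t.2.1 ∈ 𝒜 ∧ t.2.2 ∈ 𝒜 ∧ t.2.2 ⊆ t.1 ∩ t.2.1 := by
    intro t ht
    rw [h𝒯, mem_filter, mem_product, mem_product] at ht
    exact ⟨ht.1.1, ht.1.2.1, ht.1.2.2, ht.2⟩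
  refine ⟨fun U => ∑ t ∈ 𝒯 with φ t = U, w t, fun U => ?_, fun ψ hψ => ?_⟩
  · let ι : Finset ℕ × Finset ℕ × Finset ℕ → Finset ℕ × Finset ℕ × Finset ℕ :=
      fun t => (t.2.2, t.1 \ t.2.2, t.2.1 \ t.2.2)
    have hinj : Set.InjOn ι (𝒯.filter fun t => φ t = U : Finset _) := by
      rintro ⟨S, T, E⟩ ht ⟨S', T', E'⟩ ht' heq
      rw [mem_coe, mem_filter] at ht ht'
      have h1 := (hmem _ ht.1).2.2.2
      have h2 := (hmem _ ht'.1).2.2.2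
      simp only [ι, Prod.mk.injEq] at heq h1 h2 ⊢
      obtain ⟨rfl, hS, hT⟩ := heq
      refine ⟨?_, ?_, rfl⟩
      · rw [← sdiff_union_of_subset (h1.trans inter_subset_left), hS,
          sdiff_union_of_subset (h2.trans inter_subset_left)]
      · rw [← sdiff_union_of_subset (h1.trans inter_subset_right), hT,
          sdiff_union_of_subset (h2.trans inter_subset_right)]
    calc |∑ t ∈ 𝒯 with φ t = U, w t| ≤ ∑ t ∈ 𝒯 with φ t = U, |w t| := abs_sum_le_sum_abs _ _
      _ ≤ ∑ t ∈ 𝒯 with φ t = U, (∏ p ∈ (ι t).1, r p) * C ^ U.card := by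
        refine sum_le_sum fun t ht => ?_
        rw [mem_filter] at ht
        obtain ⟨hS, hT, hE, hsub⟩ := hmem t ht.1
        have h1 : 0 ≤ ∏ p ∈ t.2.2, r p := prod_nonneg fun p hp => hr _ hE p hp
        simp only [w, ι]
        rw [abs_mul, abs_of_nonneg h1, abs_prod]
        refine mul_le_mul_of_nonneg_left ?_ h1
        calc ∏ p ∈ (t.1 ∩ t.2.1) \ t.2.2, |r p - 1| ≤ ∏ _p ∈ (t.1 ∩ t.2.1) \ t.2.2, C :=
              prod_le_prod (fun _ _ => abs_nonneg _) fun p hp =>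
                hrC _ hS p (mem_inter.1 (mem_sdiff.1 hp).1).1
          _ = C ^ ((t.1 ∩ t.2.1) \ t.2.2).card := prod_const _
          _ ≤ C ^ U.card := by
            refine pow_le_pow_right₀ hC (card_le_card ?_)
            rw [← ht.2]
            exact sdiff_subset_sdiff (inter_subset_left.trans subset_union_left) le_rfl
      _ = ∑ x ∈ (𝒯.filter fun t => φ t = U).image ι, (∏ p ∈ x.1, r p) * C ^ U.card :=
        (sum_image (f := fun x : Finset ℕ × Finset ℕ × Finset ℕ =>
          (∏ p ∈ x.1, r p) * C ^ U.card) hinj).symm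
      _ ≤ ∑ x ∈ 𝒜 ×ˢ U.powerset ×ˢ U.powerset, (∏ p ∈ x.1, r p) * C ^ U.card := by
        refine sum_le_sum_of_subset_of_nonneg ?_ ?_
        · intro x hx
          obtain ⟨t, ht, rfl⟩ := mem_image.1 hx
          rw [mem_filter] at ht
          obtain ⟨hS, hT, hE, hsub⟩ := hmem t ht.1
          simp only [ι, mem_product, mem_powerset]
          refine ⟨hE, ?_, ?_⟩
          · rw [← ht.2]
            exact sdiff_subset_sdiff subset_union_left le_rfl
          · rw [← ht.2]
            exact sdiff_subset_sdiff subset_union_right le_rfl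
        · intro x hx _
          rw [mem_product] at hx
          exact mul_nonneg (prod_nonneg fun p hp => hr _ hx.1 p hp) (by positivity)
      _ = _ := by
        rw [sum_product]
        simp only [sum_const, card_product, card_powerset, nsmul_eq_mul]
        rw [sum_mul]
        refine sum_congr rfl fun S _ => ?_
        push_cast
        rw [mul_pow, show (4 : ℝ) = 2 * 2 by norm_num, mul_pow]
        ring
  · calc (∑ S ∈ 𝒜, ∏ p ∈ S, ψ p) ^ 2
        = ∑ S ∈ 𝒜, ∑ T ∈ 𝒜, (∏ p ∈ S, ψ p) * ∏ p ∈ T, ψ p := by rw [sq, sum_mul_sum]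
      _ = ∑ S ∈ 𝒜, ∑ T ∈ 𝒜, ∑ E ∈ 𝒜 with E ⊆ S ∩ T, w (S, T, E) * ∏ p ∈ φ (S, T, E), ψ p := by
        refine sum_congr rfl fun S hS => sum_congr rfl fun T hT => ?_
        rw [prod_mul_prod_expand hψ]
        refine sum_congr ?_ fun _ _ => rfl
        ext E
        rw [mem_powerset, mem_filter]
        exact ⟨fun h => ⟨hdown S hS E (h.trans inter_subset_left), h⟩, fun h => h.2⟩
      _ = ∑ t ∈ 𝒯, w t * ∏ p ∈ φ t, ψ p := by
        rw [h𝒯, sum_filter, sum_product]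
        refine sum_congr rfl fun S _ => ?_
        rw [sum_product]
        refine sum_congr rfl fun T _ => ?_
        rw [sum_filter]
      _ = ∑ U ∈ 𝒰, ∑ t ∈ 𝒯 with φ t = U, w t * ∏ p ∈ φ t, ψ p := by
        refine (sum_fiberwise_of_maps_to (fun t ht => ?_) _).symm
        obtain ⟨hS, hT, hE, hsub⟩ := hmem t ht
        exact h𝒰 _ hS _ hT _ hsub
      _ = _ := by
        refine sum_congr rfl fun U _ => ?_
        rw [sum_mul]
        refine sum_congr rfl fun t ht => ?_
        rw [(mem_filter.1 ht).2]

lemma primeFactors_injOn_squarefree {s : Set ℕ} (hs : ∀ m ∈ s, Squarefree m) :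
    Set.InjOn Nat.primeFactors s := by
  intro x hx y hy hxy
  rw [← Nat.prod_primeFactors_of_squarefree (hs x hx),
    ← Nat.prod_primeFactors_of_squarefree (hs y hy), hxy]

lemma squarefree_prod_primes {S : Finset ℕ} (hS : ∀ p ∈ S, p.Prime) :
    Squarefree (∏ p ∈ S, p) := by
  refine (Finset.squarefree_prod_of_pairwise_isCoprime ?_ fun p hp => (hS p hp).squarefree)
  intro p hp q hq hpq
  exact Nat.coprime_iff_isRelPrime.1 ((Nat.coprime_primes (hS p hp) (hS q hq)).2 hpq)

lemma mem_image_primeFactors_iff {Q : ℕ} {S : Finset ℕ} :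
    S ∈ ((Icc 1 Q).filter fun m : ℕ => Squarefree m).image Nat.primeFactors ↔
      (∀ p ∈ S, p.Prime) ∧ ∏ p ∈ S, p ≤ Q := by
  rw [mem_image]
  constructor
  · rintro ⟨m, hm, rfl⟩
    rw [mem_filter, mem_Icc] at hm
    exact ⟨fun p hp => Nat.prime_of_mem_primeFactors hp,
      (Nat.prod_primeFactors_of_squarefree hm.2).le.trans hm.1.2⟩
  · rintro ⟨h1, h2⟩
    refine ⟨∏ p ∈ S, p, ?_, Nat.primeFactors_prod h1⟩
    rw [mem_filter, mem_Icc]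
    exact ⟨⟨prod_pos fun p hp => (h1 p hp).pos, h2⟩, squarefree_prod_primes h1⟩

variable {k : ℕ} (a b : Fin k → ℤ)

lemma exists_beta_expansion (hk : 1 ≤ k) (hγ : ∀ m : ℕ, 1 ≤ m → 0 < gamma a b m) {R : ℕ}
    (hR : 1 ≤ R) :
    ∃ W : ℕ → ℝ, (∀ m, |W m| ≤ (4 * (k * (k + 1)) : ℝ) ^ m.primeFactors.card) ∧
      ∀ n : ℤ, beta a b R n = ∑ m ∈ Icc 1 (R ^ 2) with Squarefree m, W m * psiProd a b m n := by
  have hk' : (1 : ℝ) ≤ k := by exact_mod_cast hk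
  have hC : (1 : ℝ) ≤ k * (k + 1) := by nlinarith
  have hG := one_le_G a b hγ hR
  have hinj : ∀ Q : ℕ, Set.InjOn Nat.primeFactors
      ((Icc 1 Q).filter fun m : ℕ => Squarefree m : Finset ℕ) := fun Q =>
    primeFactors_injOn_squarefree fun m hm => (mem_filter.1 hm).2
  obtain ⟨W, hW, hexp⟩ := exists_sq_sum_expansion
    (((Icc 1 R).filter fun m : ℕ => Squarefree m).image Nat.primeFactors)
    (((Icc 1 (R ^ 2)).filter fun m : ℕ => Squarefree m).image Nat.primeFactors)
    (by
      intro S hS E hE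
      rw [mem_image_primeFactors_iff] at hS ⊢
      refine ⟨fun p hp => hS.1 p (hE hp), le_trans ?_ hS.2⟩
      exact prod_le_prod_of_subset_of_one_le' hE fun p hp _ => (hS.1 p hp).one_le)
    (by
      intro S hS T hT E _
      rw [mem_image_primeFactors_iff] at hS hT ⊢
      have hST : ∀ p ∈ S ∪ T, p.Prime := fun p hp =>
        (mem_union.1 hp).elim (hS.1 p) (hT.1 p)
      refine ⟨fun p hp => hST p (mem_sdiff.1 hp).1, ?_⟩
      calc ∏ p ∈ (S ∪ T) \ E, p ≤ ∏ p ∈ S ∪ T, p :=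
            prod_le_prod_of_subset_of_one_le' sdiff_subset fun p hp _ => (hST p hp).one_le
        _ ≤ (∏ p ∈ S ∪ T, p) * ∏ p ∈ S ∩ T, p :=
            Nat.le_mul_of_pos_right _ (prod_pos fun p hp => (hS.1 p (mem_inter.1 hp).1).pos)
        _ = (∏ p ∈ S, p) * ∏ p ∈ T, p := prod_union_inter
        _ ≤ R ^ 2 := by
            rw [sq]
            exact Nat.mul_le_mul hS.2 hT.2)
    (ratio a b)
    (by
      intro S hS p hp
      have hpp := (mem_image_primeFactors_iff.1 hS).1 p hp
      exact ratio_nonneg a b hpp (hγ p hpp.one_le))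
    hC
    (by
      intro S hS p hp
      have hpp := (mem_image_primeFactors_iff.1 hS).1 p hp
      have h1 := ratio_nonneg a b hpp (hγ p hpp.one_le)
      have h2 := ratio_le a b hpp (hγ p hpp.one_le)
      have h3 : (k * (k + 1) : ℝ) / p ≤ k * (k + 1) :=
        div_le_self (by linarith) (by exact_mod_cast hpp.one_le)
      rw [abs_le]
      constructor <;> linarith)
  refine ⟨fun m => W m.primeFactors / G a b R, fun m => ?_, fun n => ?_⟩
  -- The sum of weights in the bound for `W` is exactly `G(R)`, so the normalisation of `β_R`
  -- cancels it.
  · rw [abs_div, abs_of_pos (by linarith : 0 < G a b R), div_le_iff₀ (by linarith), mul_comm]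
    refine (hW _).trans (le_of_eq ?_)
    rw [sum_image (hinj R), ← G_eq]
  · have h1 := hexp (fun p => psi a b p n) (fun p => psi_sq a b p n)
    rw [sum_image (hinj R), sum_image (hinj (R ^ 2))] at h1
    rw [beta, alpha_eq a b hγ, Complex.norm_real, Real.norm_eq_abs, sq_abs]
    simp only [psiProd]
    rw [h1, sum_div]
    exact sum_congr rfl fun m _ => by ring

lemma beta_nonneg (hγ : ∀ m : ℕ, 1 ≤ m → 0 < gamma a b m) {R : ℕ} (hR : 1 ≤ R) (n : ℤ) :
    0 ≤ beta a b R n :=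
  div_nonneg (sq_nonneg _) (zero_le_one.trans (one_le_G a b hγ hR))

end

section

variable {k : ℕ}

/-! ### Pointwise bound -/

lemma abs_F_le (a b : Fin k → ℤ) {N : ℕ} (hab : ∀ j, |a j| ≤ (N : ℤ) ∧ |b j| ≤ (N : ℤ))
    {n : ℕ} (hn : 1 ≤ n) (hnN : n ≤ N) : |F a b n| ≤ (2 * (N : ℤ) ^ 2) ^ k := by
  rw [F, abs_prod]
  calc ∏ j, |a j * n + b j| ≤ ∏ _j : Fin k, (2 * (N : ℤ) ^ 2) := by
        refine prod_le_prod (fun _ _ => abs_nonneg _) fun j _ => ?_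
        refine (abs_add_le _ _).trans ?_
        rw [abs_mul, Nat.abs_cast]
        have h1 : (n : ℤ) ≤ N := by exact_mod_cast hnN
        have h2 : (1 : ℤ) ≤ n := by exact_mod_cast hn
        have h3 : |a j| * n ≤ N * N := mul_le_mul (hab j).1 h1 (by positivity) (by positivity)
        nlinarith [(hab j).2]
    _ = _ := by simp

lemma exists_beta_le (hk : 1 ≤ k) {A δ : ℝ} (hA : 0 < A) (hδ : 0 < δ) :
    ∃ K : ℝ, 0 < K ∧ ∀ (N R : ℕ) (a b : Fin k → ℤ), 1 ≤ N → 1 ≤ R →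
      (R : ℝ) ≤ A * (N : ℝ) ^ (1 / 10 : ℝ) → (∀ m : ℕ, 1 ≤ m → 0 < gamma a b m) →
      (∀ j, |a j| ≤ (N : ℤ) ∧ |b j| ≤ (N : ℤ)) →
      ∀ n : ℕ, 1 ≤ n → n ≤ N → F a b n ≠ 0 → beta a b R n ≤ K * (N : ℝ) ^ δ := by
  have hk' : (1 : ℝ) ≤ k := by exact_mod_cast hk
  have hC : (1 : ℝ) ≤ k * (k + 1) := by nlinarith
  have hk0 : (k : ℝ) ≠ 0 := by positivity
  obtain ⟨K₁, hK₁, h₁⟩ := exists_sum_gcd_le hC (show 0 < δ / 4 by positivity)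
  -- Since `|F(n)| ≤ (2N²)^k`, the exponent `δ/(8k)` costs `N^(δ/4)`. With `R^(δ/4)` this gives
  -- `N^(δ/2)` for `α_R`, hence `N^δ` after squaring.
  obtain ⟨K₂, hK₂, h₂⟩ := exists_card_sqfDivisors_le (show 0 < δ / (8 * k) by positivity)
  refine ⟨(K₁ * A ^ (δ / 4) * (K₂ * 2 ^ (δ / 8))) ^ 2, by positivity, ?_⟩
  intro N R a b hN hR hRN hγ hab n hn hnN hF
  have hN1 : (1 : ℝ) ≤ N := by exact_mod_cast hN
  have hN0 : (0 : ℝ) < N := by linarith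
  have hG := one_le_G a b hγ hR
  have hRpow : (R : ℝ) ^ (δ / 4) ≤ A ^ (δ / 4) * (N : ℝ) ^ (δ / 4) := by
    rw [← Real.mul_rpow hA.le hN0.le]
    refine Real.rpow_le_rpow (by positivity) (hRN.trans ?_) (by positivity)
    gcongr
    calc (N : ℝ) ^ (1 / 10 : ℝ) ≤ (N : ℝ) ^ (1 : ℝ) :=
          Real.rpow_le_rpow_of_exponent_le hN1 (by norm_num)
      _ = N := Real.rpow_one _
  have hFpow : (|F a b n| : ℝ) ^ (δ / (8 * k)) ≤ 2 ^ (δ / 8) * (N : ℝ) ^ (δ / 4) := by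
    have h3 : (|F a b n| : ℝ) ≤ (2 * (N : ℝ) ^ 2) ^ k := by
      exact_mod_cast abs_F_le a b hab hn hnN
    calc (|F a b n| : ℝ) ^ (δ / (8 * k)) ≤ ((2 * (N : ℝ) ^ 2) ^ k) ^ (δ / (8 * k)) :=
          Real.rpow_le_rpow (abs_nonneg _) h3 (by positivity)
      _ = (2 * (N : ℝ) ^ 2) ^ (δ / 8) := by
          rw [← Real.rpow_natCast, ← Real.rpow_mul (by positivity)]
          congr 1
          field_simp
      _ = 2 ^ (δ / 8) * (N : ℝ) ^ (δ / 4) := by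
          rw [Real.mul_rpow (by norm_num) (by positivity), ← Real.rpow_natCast,
            ← Real.rpow_mul hN0.le]
          congr 2
          push_cast
          ring
  have hα : ‖alpha a b R n‖ ≤
      K₁ * A ^ (δ / 4) * (K₂ * 2 ^ (δ / 8)) * (N : ℝ) ^ (δ / 2) := by
    rw [alpha_eq a b hγ, Complex.norm_real, Real.norm_eq_abs]
    calc |∑ m ∈ Icc 1 R with Squarefree m, psiProd a b m n|
        ≤ ∑ m ∈ Icc 1 R with Squarefree m, |psiProd a b m n| := abs_sum_le_sum_abs _ _
      _ ≤ ∑ m ∈ Icc 1 R with Squarefree m,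
            (k * (k + 1) : ℝ) ^ m.primeFactors.card * (Int.gcd (m : ℤ) (F a b n) / m) :=
          sum_le_sum fun m hm => abs_psiProd_le a b hk hγ (mem_filter.1 hm).2 n
      _ ≤ K₁ * (R : ℝ) ^ (δ / 4) * (sqfDivisors R (F a b n)).card := h₁ R _ hR
      _ ≤ K₁ * (A ^ (δ / 4) * (N : ℝ) ^ (δ / 4)) *
            (K₂ * (2 ^ (δ / 8) * (N : ℝ) ^ (δ / 4))) := by
          gcongr
          exact (h₂ R _ hF).trans (by gcongr)
      _ = K₁ * A ^ (δ / 4) * (K₂ * 2 ^ (δ / 8)) * ((N : ℝ) ^ (δ / 4) * (N : ℝ) ^ (δ / 4)) := by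
          ring
      _ = _ := by
          rw [← Real.rpow_add hN0]
          congr 2
          ring
  calc beta a b R n ≤ ‖alpha a b R n‖ ^ 2 := div_le_self (sq_nonneg _) hG
    _ ≤ (K₁ * A ^ (δ / 4) * (K₂ * 2 ^ (δ / 8)) * (N : ℝ) ^ (δ / 2)) ^ 2 :=
        pow_le_pow_left₀ (norm_nonneg _) hα 2
    _ = _ := by
        rw [mul_pow _ ((N : ℝ) ^ (δ / 2)), ← Real.rpow_natCast ((N : ℝ) ^ (δ / 2)),
          ← Real.rpow_mul hN0.le]
        congr 2
        push_cast
        ring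

/-! ### The contribution of large moduli -/

lemma norm_sum_pow_le {z : ℂ} (hz : ‖z‖ = 1) (N : ℕ) : ‖∑ n ∈ Icc 1 N, z ^ n‖ ≤ N := by
  refine (norm_sum_le _ _).trans ?_
  simp [hz]

lemma norm_sum_pow_mul_le {z : ℂ} (hz : ‖z‖ = 1) (N : ℕ) :
    ‖∑ n ∈ Icc 1 N, z ^ n‖ * ‖z - 1‖ ≤ 2 := by
  have h1 : ∑ n ∈ Icc 1 N, z ^ n = z * ∑ n ∈ range N, z ^ n := by
    have h2 : Icc 1 N = Ico (0 + 1) (N + 1) := by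
      ext n
      simp only [mem_Icc, mem_Ico]
      omega
    rw [mul_sum, range_eq_Ico, h2, ← sum_Ico_add' (fun n => z ^ n) 0 N 1]
    exact sum_congr rfl fun n _ => pow_succ' z n
  rw [← norm_mul, h1, mul_assoc, geom_sum_mul, norm_mul, hz, one_mul]
  refine (norm_sub_le _ _).trans ?_
  rw [norm_pow, hz]
  norm_num

/-- Equal characters mean that `c/m` and `c'/m'` differ by an integer. Both lie in `[0, 1)`, so they
coincide, and reduced fractions are unique. -/
lemma e_eq_e_reduced {m m' c c' : ℕ} (hm : 0 < m) (hm' : 0 < m') (hc : c ∈ reducedResidues m)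
    (hc' : c' ∈ reducedResidues m') (h : e m c = e m' c') : m = m' ∧ c = c' := by
  rw [reducedResidues, mem_filter, mem_range] at hc hc'
  have h1 : e (m * m') (m' * c + m * (-c')) = 1 := by
    rw [e_mul_add hm hm', h, e_neg, mul_inv_cancel₀ (e_ne_zero _ _)]
  rw [e_eq_one_iff (Nat.mul_pos hm hm')] at h1
  have h2 : ((m' * c : ℕ) : ℤ) ≡ (m * c' : ℕ) [ZMOD (m * m' : ℕ)] := by
    refine (Int.modEq_iff_dvd.2 ?_).symm
    convert h1 using 1
    push_cast
    ring
  have h3 : m' * c = m * c' := by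
    refine Nat.ModEq.eq_of_lt_of_lt (Int.natCast_modEq_iff.1 h2) ?_ ?_
    · rw [mul_comm m m']
      exact Nat.mul_lt_mul_of_pos_left hc.1 hm'
    · exact Nat.mul_lt_mul_of_pos_left hc'.1 hm
  have h4 : m ∣ m' := (Nat.Coprime.symm hc.2).dvd_of_dvd_mul_right ⟨c', h3⟩
  have h5 : m' ∣ m := (Nat.Coprime.symm hc'.2).dvd_of_dvd_mul_right ⟨c, h3.symm⟩
  have h6 := Nat.dvd_antisymm h4 h5
  refine ⟨h6, ?_⟩
  rw [h6] at h3
  exact Nat.eq_of_mul_eq_mul_left hm' h3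

/-- Distinct reduced fractions are well spaced on the circle. -/
lemma one_le_mul_norm_e_sub {m m' c c' : ℕ} (hm : 0 < m) (hm' : 0 < m')
    (hc : c ∈ reducedResidues m) (hc' : c' ∈ reducedResidues m') (hne : ¬ (m = m' ∧ c = c')) :
    1 ≤ ((m * m' : ℕ) : ℝ) * ‖e m (-c) - e m' (-c')‖ := by
  set z := e m (-c) * e m' c' with hz
  have hmm := Nat.mul_pos hm hm'
  have hzform : z = e (m * m') (m' * (-c) + m * c') := (e_mul_add hm hm' _ _).symm
  have hzpow : z ^ (m * m') = 1 := by
    rw [hzform, e_pow, e_eq_one_iff hmm]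
    exact dvd_mul_left _ _
  have hz1 : z ≠ 1 := by
    intro h
    rw [hz, e_neg, inv_mul_eq_one₀ (e_ne_zero _ _)] at h
    exact hne (e_eq_e_reduced hm hm' hc hc' h)
  have hzn : ‖z‖ = 1 := by rw [hz, norm_mul, norm_e, norm_e, one_mul]
  have h1 : ‖e m (-c) - e m' (-c')‖ = ‖z - 1‖ := by
    have : z - 1 = (e m (-c) - e m' (-c')) * e m' c' := by
      rw [sub_mul, ← e_add m' (-c') c', neg_add_cancel, e_zero]
    rw [this, norm_mul, norm_e, mul_one]
  rw [h1]
  exact one_le_mul_norm_root_sub_one hmm hzpow hz1 hzn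

/-- Two such fractions would be at distance less than `1/M²` on the circle, against the spacing
`1/(mm') ≥ 1/M²`. -/
lemma card_near_le_one {M : ℕ} (w : ℂ) (hw : ‖w‖ = 1)
    {I : Finset ((_ : ℕ) × ℕ)} (hI : ∀ i ∈ I, 0 < i.1 ∧ i.1 ≤ M ∧ i.2 ∈ reducedResidues i.1) :
    (I.filter fun i => 2 * (M : ℝ) ^ 2 * ‖w * e i.1 (-(i.2 : ℤ)) - 1‖ < 1).card ≤ 1 := by
  rw [card_le_one]
  rintro ⟨m, c⟩ hi ⟨m', c'⟩ hi'
  rw [mem_filter] at hi hi'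
  obtain ⟨hm, hmM, hc⟩ := hI _ hi.1
  obtain ⟨hm', hmM', hc'⟩ := hI _ hi'.1
  by_contra hne
  have h1 := one_le_mul_norm_e_sub hm hm' hc hc' (by
    rintro ⟨h2, h3⟩
    simp only at h2 h3
    subst h2 h3
    exact hne rfl)
  simp only at h1 hm hmM hc hm' hmM' hc'
  have h2 : ‖e m (-(c : ℤ)) - e m' (-(c' : ℤ))‖ ≤
      ‖w * e m (-(c : ℤ)) - 1‖ + ‖w * e m' (-(c' : ℤ)) - 1‖ := by
    calc ‖e m (-(c : ℤ)) - e m' (-(c' : ℤ))‖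
        = ‖w * (e m (-(c : ℤ)) - e m' (-(c' : ℤ)))‖ := by rw [norm_mul, hw, one_mul]
      _ = ‖(w * e m (-(c : ℤ)) - 1) - (w * e m' (-(c' : ℤ)) - 1)‖ := by
          congr 1
          ring
      _ ≤ _ := norm_sub_le _ _
  have h3 : ((m * m' : ℕ) : ℝ) ≤ (M : ℝ) ^ 2 := by
    rw [sq]
    exact_mod_cast Nat.mul_le_mul hmM hmM'
  have h4 : ((m * m' : ℕ) : ℝ) * ‖e m (-(c : ℤ)) - e m' (-(c' : ℤ))‖ ≤
      (M : ℝ) ^ 2 * (‖w * e m (-(c : ℤ)) - 1‖ + ‖w * e m' (-(c' : ℤ)) - 1‖) := by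
    gcongr
  have h5 := hi.2
  have h6 := hi'.2
  simp only at h5 h6
  linarith

lemma card_reducedResidues_le (m : ℕ) : (reducedResidues m).card ≤ m := by
  refine (card_filter_le _ _).trans ?_
  simp

/-- Expanding into fractions `c/m` leaves geometric sums with coefficients `≪ m^(ε-1)`. At most one
fraction is close to the frequency; it gets the trivial bound `N` and its modulus exceeds `Q`. All
others have geometric sums `≪ R⁴`, and the hypothesis on `R` makes their total `R⁷ ≪ N^(7/10)`. -/
lemma exists_tail_le (hk : 1 ≤ k) {A D ε : ℝ} (hA : 0 < A) (hD : 1 ≤ D) (hε : 0 < ε)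
    (hε1 : ε ≤ 1) :
    ∃ K : ℝ, 0 < K ∧ ∀ (N R Q : ℕ) (a b : Fin k → ℤ) (W : ℕ → ℝ), 1 ≤ N → 1 ≤ Q →
      (R : ℝ) ≤ A * (N : ℝ) ^ (1 / 10 : ℝ) → (∀ m : ℕ, 1 ≤ m → 0 < gamma a b m) →
      (∀ m, |W m| ≤ D ^ m.primeFactors.card) → ∀ x : ℤ,
      ‖∑ n ∈ Icc 1 N, ((∑ m ∈ (Icc 1 (R ^ 2)).filter Squarefree with Q < m,
        W m * psiProd a b m n : ℝ) : ℂ) * e N (x * n)‖ ≤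
          K * (N * (Q : ℝ) ^ (ε - 1) + (N : ℝ) ^ (7 / 10 : ℝ)) := by
  have hk' : (1 : ℝ) ≤ k := by exact_mod_cast hk
  have hC : (1 : ℝ) ≤ k * (k + 1) := by nlinarith
  have hDC : 1 ≤ D * (k * (k + 1)) := by nlinarith
  obtain ⟨K₁, hK₁, h₁⟩ := exists_pow_card_primeFactors_le hDC hε
  obtain ⟨K₂, hK₂, h₂⟩ := exists_pow_card_primeFactors_le hDC (show (0 : ℝ) < 1 / 2 by norm_num)
  refine ⟨K₁ + 4 * K₂ * A ^ 7, by positivity, ?_⟩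
  intro N R Q a b W hN hQ hRN hγ hW x
  have hN1 : (1 : ℝ) ≤ N := by exact_mod_cast hN
  have hN0 : (0 : ℝ) < N := by linarith
  set J := ((Icc 1 (R ^ 2)).filter Squarefree).filter fun m : ℕ => Q < m with hJ
  set I : Finset ((_ : ℕ) × ℕ) := J.sigma fun m => reducedResidues m with hIdef
  have hJmem : ∀ m ∈ J, 0 < m ∧ m ≤ R ^ 2 ∧ Squarefree m ∧ Q < m := by
    intro m hm
    rw [hJ, mem_filter, mem_filter, mem_Icc] at hm
    exact ⟨hm.1.1.1, hm.1.1.2, hm.1.2, hm.2⟩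
  have hImem : ∀ i ∈ I, i.1 ∈ J ∧ i.2 ∈ reducedResidues i.1 := fun i hi => mem_sigma.1 hi
  let z : (_ : ℕ) × ℕ → ℂ := fun i => e N x * e i.1 (-(i.2 : ℤ))
  have hz : ∀ i, ‖z i‖ = 1 := fun i => by simp only [z]; rw [norm_mul, norm_e, norm_e, one_mul]
  let coef : (_ : ℕ) × ℕ → ℂ := fun i => W i.1 * s a b i.2 i.1
  have hcoef : ∀ i ∈ I, ‖coef i‖ ≤ (D * (k * (k + 1))) ^ i.1.primeFactors.card / i.1 := by
    intro i hi
    obtain ⟨hi1, hi2⟩ := hImem i hi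
    obtain ⟨hm, -, hsq, -⟩ := hJmem _ hi1
    have hcop : IsCoprime (i.2 : ℤ) (i.1 : ℤ) := by
      rw [reducedResidues, mem_filter] at hi2
      exact Nat.isCoprime_iff_coprime.2 hi2.2
    simp only [coef]
    rw [norm_mul, Complex.norm_real, Real.norm_eq_abs, s_eq_sInt, mul_pow, mul_div_assoc]
    exact mul_le_mul (hW _) ((norm_sInt_le a b hγ hm hcop).trans (prod_ratio_le a b hγ hsq))
      (norm_nonneg _) (by positivity)
  have hexpand : ∑ n ∈ Icc 1 N, ((∑ m ∈ J, W m * psiProd a b m n : ℝ) : ℂ) * e N (x * n) =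
      ∑ i ∈ I, coef i * ∑ n ∈ Icc 1 N, z i ^ n := by
    simp only [mul_sum]
    rw [sum_comm]
    refine sum_congr rfl fun n _ => ?_
    rw [hIdef, sum_sigma]
    push_cast
    rw [sum_mul]
    refine sum_congr rfl fun m hm => ?_
    obtain ⟨hm0, -, hsq, -⟩ := hJmem _ hm
    have h3 := alphaPart_eq_psiProd a b hγ hm0 n
    rw [if_pos hsq] at h3
    rw [← h3, alphaPart, mul_sum, sum_mul]
    refine sum_congr rfl fun c _ => ?_
    simp only [coef, z]
    rw [mul_pow, e_pow, e_pow, neg_mul]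
    ring
  set near := I.filter fun i => 2 * ((R ^ 2 : ℕ) : ℝ) ^ 2 * ‖z i - 1‖ < 1 with hnear
  have hnearcard : near.card ≤ 1 := card_near_le_one (e N x) (norm_e _ _) (fun i hi => by
    obtain ⟨hi1, hi2⟩ := hImem i hi
    obtain ⟨hm, hmR, -, -⟩ := hJmem _ hi1
    exact ⟨hm, hmR, hi2⟩)
  have hQ0 : (0 : ℝ) < Q := by exact_mod_cast hQ
  have hnearsum : ∑ i ∈ near, ‖coef i * ∑ n ∈ Icc 1 N, z i ^ n‖ ≤
      K₁ * (N * (Q : ℝ) ^ (ε - 1)) := by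
    have hbound : ∀ i ∈ near, ‖coef i * ∑ n ∈ Icc 1 N, z i ^ n‖ ≤
        K₁ * (N * (Q : ℝ) ^ (ε - 1)) := by
      intro i hi
      have hiI := (mem_filter.1 hi).1
      obtain ⟨hi1, -⟩ := hImem i hiI
      obtain ⟨hm, -, -, hQm⟩ := hJmem _ hi1
      have hm0 : (0 : ℝ) < i.1 := by exact_mod_cast hm
      rw [norm_mul]
      calc ‖coef i‖ * ‖∑ n ∈ Icc 1 N, z i ^ n‖
          ≤ (K₁ * (i.1 : ℝ) ^ ε / i.1) * N := by
            refine mul_le_mul ((hcoef i hiI).trans ?_) (norm_sum_pow_le (hz i) N)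
              (norm_nonneg _) (by positivity)
            gcongr
            exact h₁ i.1 hm.ne'
        _ = K₁ * (N * (i.1 : ℝ) ^ (ε - 1)) := by
            rw [Real.rpow_sub_one hm0.ne']
            ring
        _ ≤ _ := by
            gcongr K₁ * (N * ?_)
            exact Real.rpow_le_rpow_of_nonpos hQ0 (by exact_mod_cast hQm.le) (by linarith)
    calc _ ≤ near.card • (K₁ * (N * (Q : ℝ) ^ (ε - 1))) := sum_le_card_nsmul _ _ _ hbound
      _ ≤ _ := by
        rw [nsmul_eq_mul]
        have : (near.card : ℝ) ≤ 1 := by exact_mod_cast hnearcard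
        exact mul_le_of_le_one_left (by positivity) this
  -- Away from the frequency the geometric sum is at most `2/|z - 1| ≤ 4R⁴`. Coefficients are `≪
  -- m^(-1/2) ≤ R/m`, so the at most `m` numerators cost `R` per modulus, and there are at most `R²`
  -- moduli.
  have hfarsum : ∑ i ∈ I.filter fun i => ¬ 2 * ((R ^ 2 : ℕ) : ℝ) ^ 2 * ‖z i - 1‖ < 1,
      ‖coef i * ∑ n ∈ Icc 1 N, z i ^ n‖ ≤ 4 * K₂ * A ^ 7 * (N : ℝ) ^ (7 / 10 : ℝ) := by
    calc _ ≤ ∑ i ∈ I.filter fun i => ¬ 2 * ((R ^ 2 : ℕ) : ℝ) ^ 2 * ‖z i - 1‖ < 1,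
          K₂ * R / i.1 * (4 * (R : ℝ) ^ 4) := by
          refine sum_le_sum fun i hi => ?_
          rw [mem_filter, not_lt] at hi
          obtain ⟨hi1, -⟩ := hImem i hi.1
          obtain ⟨hm, hmR, -, -⟩ := hJmem _ hi1
          rw [norm_mul]
          refine mul_le_mul ((hcoef i hi.1).trans ?_) ?_ (norm_nonneg _) (by positivity)
          · gcongr
            refine (h₂ i.1 hm.ne').trans ?_
            gcongr
            rw [← Real.sqrt_eq_rpow]
            refine Real.sqrt_le_iff.2 ⟨by positivity, by exact_mod_cast hmR⟩
          · have h3 := norm_sum_pow_mul_le (hz i) N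
            have h4 := hi.2
            push_cast at h4
            calc ‖∑ n ∈ Icc 1 N, z i ^ n‖
                ≤ ‖∑ n ∈ Icc 1 N, z i ^ n‖ * (2 * ((R : ℝ) ^ 2) ^ 2 * ‖z i - 1‖) :=
                  le_mul_of_one_le_right (norm_nonneg _) h4
              _ = 2 * (R : ℝ) ^ 4 * (‖∑ n ∈ Icc 1 N, z i ^ n‖ * ‖z i - 1‖) := by ring
              _ ≤ 2 * (R : ℝ) ^ 4 * 2 := by gcongr
              _ = _ := by ring
      _ ≤ ∑ i ∈ I, K₂ * R / i.1 * (4 * (R : ℝ) ^ 4) :=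
          sum_le_sum_of_subset_of_nonneg (filter_subset _ _) fun _ _ _ => by positivity
      _ = ∑ m ∈ J, (reducedResidues m).card * (K₂ * R / m * (4 * (R : ℝ) ^ 4)) := by
          rw [hIdef, sum_sigma]
          simp
      _ ≤ ∑ m ∈ J, 4 * K₂ * (R : ℝ) ^ 5 := by
          refine sum_le_sum fun m hm => ?_
          have hm0 : (0 : ℝ) < m := by exact_mod_cast (hJmem m hm).1
          calc ((reducedResidues m).card : ℝ) * (K₂ * R / m * (4 * (R : ℝ) ^ 4))
              ≤ (m : ℝ) * (K₂ * R / m * (4 * (R : ℝ) ^ 4)) := by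
                gcongr
                exact card_reducedResidues_le m
            _ = _ := by field_simp
      _ ≤ (R : ℝ) ^ 2 * (4 * K₂ * (R : ℝ) ^ 5) := by
          rw [sum_const, nsmul_eq_mul]
          gcongr
          have : J.card ≤ R ^ 2 := by
            refine (card_filter_le _ _).trans ((card_filter_le _ _).trans ?_)
            simp
          exact_mod_cast this
      _ = 4 * K₂ * (R : ℝ) ^ 7 := by ring
      _ ≤ 4 * K₂ * (A * (N : ℝ) ^ (1 / 10 : ℝ)) ^ 7 := by gcongr
      _ = 4 * K₂ * A ^ 7 * (N : ℝ) ^ (7 / 10 : ℝ) := by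
          rw [mul_pow, ← Real.rpow_natCast ((N : ℝ) ^ (1 / 10 : ℝ)), ← Real.rpow_mul hN0.le]
          norm_num
          ring
  rw [hexpand]
  calc ‖∑ i ∈ I, coef i * ∑ n ∈ Icc 1 N, z i ^ n‖
      ≤ ∑ i ∈ I, ‖coef i * ∑ n ∈ Icc 1 N, z i ^ n‖ := norm_sum_le _ _
    _ = ∑ i ∈ near, ‖coef i * ∑ n ∈ Icc 1 N, z i ^ n‖ +
          ∑ i ∈ I.filter fun i => ¬ 2 * ((R ^ 2 : ℕ) : ℝ) ^ 2 * ‖z i - 1‖ < 1,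
            ‖coef i * ∑ n ∈ Icc 1 N, z i ^ n‖ := (sum_filter_add_sum_filter_not _ _ _).symm
    _ ≤ K₁ * (N * (Q : ℝ) ^ (ε - 1)) + 4 * K₂ * A ^ 7 * (N : ℝ) ^ (7 / 10 : ℝ) :=
        add_le_add hnearsum hfarsum
    _ ≤ _ := by
        have h3 : 0 ≤ N * (Q : ℝ) ^ (ε - 1) := by positivity
        have h4 : 0 ≤ (N : ℝ) ^ (7 / 10 : ℝ) := by positivity
        have h5 : 0 ≤ 4 * K₂ * A ^ 7 := by positivity
        nlinarith

end

section

variable {k : ℕ}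

/-! ### The restricted estimate -/

/-- The exponential sum with coefficients `f`. -/
def expSum {N : ℕ} [NeZero N] (f : ZMod N → ℂ) (n : ℕ) : ℂ :=
  ∑ x : ZMod N, f x * e N ((x.val : ℤ) * (n : ℤ))

lemma sum_norm_sq_expSum_mul {N : ℕ} [NeZero N] (f : ZMod N → ℂ) (w : ℕ → ℝ) :
    ((∑ n ∈ Icc 1 N, ‖expSum f n‖ ^ 2 * w n : ℝ) : ℂ) =
      ∑ x : ZMod N, ∑ y : ZMod N, f x * (starRingEnd ℂ) (f y) *
        ∑ n ∈ Icc 1 N, (w n : ℂ) * e N (((x.val : ℤ) - y.val) * n) := by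
  push_cast
  simp only [mul_sum]
  rw [sum_congr rfl fun x _ => sum_comm, sum_comm]
  refine sum_congr rfl fun n _ => ?_
  rw [← Complex.mul_conj', expSum, map_sum, sum_mul_sum, sum_mul]
  refine sum_congr rfl fun x _ => ?_
  rw [sum_mul]
  refine sum_congr rfl fun y _ => ?_
  rw [map_mul, conj_e, sub_mul, sub_eq_add_neg, e_add]
  ring

lemma sum_norm_sq_expSum {N : ℕ} [NeZero N] (f : ZMod N → ℂ) :
    ∑ n ∈ Icc 1 N, ‖expSum f n‖ ^ 2 = N * ∑ x, ‖f x‖ ^ 2 := by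
  have hN : 0 < N := Nat.pos_of_ne_zero (NeZero.ne N)
  have h := sum_norm_sq_expSum_mul f (fun _ => 1)
  simp only [mul_one] at h
  have key : ∀ x y : ZMod N, ∑ n ∈ Icc 1 N, ((1 : ℝ) : ℂ) * e N (((x.val : ℤ) - y.val) * n) =
      if x = y then (N : ℂ) else 0 := by
    intro x y
    simp only [Complex.ofReal_one, one_mul]
    -- Both `1, …, N` and `0, …, N - 1` are complete residue systems.
    have hshift : ∑ n ∈ Icc 1 N, e N (((x.val : ℤ) - y.val) * n) =
        ∑ n ∈ range N, e N (((x.val : ℤ) - y.val) * n) := by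
      have h2 : Icc 1 N = Ico (0 + 1) (N + 1) := by
        ext n
        simp only [mem_Icc, mem_Ico]
        omega
      rw [h2, ← sum_Ico_add' (fun n : ℕ => e N (((x.val : ℤ) - y.val) * n)) 0 N 1, ← range_eq_Ico]
      have := sum_add_shift hN (f := fun n => e N (((x.val : ℤ) - y.val) * n))
        (fun u v huv => e_congr (huv.mul_left _)) 1
      rw [← this]
      exact sum_congr rfl fun n _ => by push_cast; rfl
    rw [hshift, sum_e_mul hN]
    refine if_congr ?_ rfl rfl
    constructor
    · intro hdvd
      have h3 : (y.val : ℤ) ≡ x.val [ZMOD N] := Int.modEq_iff_dvd.2 hdvd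
      exact ZMod.val_injective N (Nat.ModEq.eq_of_lt_of_lt (Int.natCast_modEq_iff.1 h3)
        y.val_lt x.val_lt).symm
    · rintro rfl
      simp
  simp only [key, mul_ite, mul_zero, sum_ite_eq, mem_univ, if_true, Complex.mul_conj'] at h
  have h4 : ((∑ n ∈ Icc 1 N, ‖expSum f n‖ ^ 2 : ℝ) : ℂ) = ((N * ∑ x, ‖f x‖ ^ 2 : ℝ) : ℂ) := by
    rw [h]
    push_cast
    rw [mul_comm, sum_mul]
  exact_mod_cast h4

section Restricted

variable {N : ℕ} [NeZero N] {f : ZMod N → ℂ} {B : Finset (ZMod N)} {L : ℝ}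

lemma sum_norm_le_of_support (hfL : ∀ x, ‖f x‖ ≤ L) (hfB : ∀ x, x ∉ B → f x = 0) :
    ∑ x, ‖f x‖ ≤ B.card * L := by
  rw [← sum_subset (subset_univ B) fun x _ hx => by rw [hfB x hx, norm_zero]]
  refine (sum_le_card_nsmul _ _ L fun x _ => hfL x).trans ?_
  rw [nsmul_eq_mul]

lemma sum_norm_sq_le_of_support (hfL : ∀ x, ‖f x‖ ≤ L)
    (hfB : ∀ x, x ∉ B → f x = 0) : ∑ x, ‖f x‖ ^ 2 ≤ B.card * L ^ 2 := by
  rw [← sum_subset (subset_univ B) fun x _ hx => by rw [hfB x hx, norm_zero]; norm_num]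
  refine (sum_le_card_nsmul _ _ (L ^ 2) fun x _ =>
    pow_le_pow_left₀ (norm_nonneg _) (hfL x) 2).trans ?_
  rw [nsmul_eq_mul]

lemma norm_expSum_le (hfL : ∀ x, ‖f x‖ ≤ L) (hfB : ∀ x, x ∉ B → f x = 0) (n : ℕ) :
    ‖expSum f n‖ ≤ B.card * L := by
  refine (norm_sum_le _ _).trans (le_trans ?_ (sum_norm_le_of_support hfL hfB))
  refine sum_le_sum fun x _ => ?_
  rw [norm_mul, norm_e, mul_one]

/-- Opening the square produces the Fourier coefficients of `w` at differences of frequencies, which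
are then estimated by absolute values. -/
lemma sum_norm_sq_expSum_mul_le_of_fourier (hfL : ∀ x, ‖f x‖ ≤ L)
    (hfB : ∀ x, x ∉ B → f x = 0) {w : ℕ → ℝ} {V : ℝ}
    (hw : ∀ x : ℤ, ‖∑ n ∈ Icc 1 N, (w n : ℂ) * e N (x * n)‖ ≤ V) :
    ∑ n ∈ Icc 1 N, ‖expSum f n‖ ^ 2 * w n ≤ (B.card * L) ^ 2 * V := by
  have hV : 0 ≤ V := (norm_nonneg _).trans (hw 0)
  calc ∑ n ∈ Icc 1 N, ‖expSum f n‖ ^ 2 * w n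
      ≤ ‖((∑ n ∈ Icc 1 N, ‖expSum f n‖ ^ 2 * w n : ℝ) : ℂ)‖ := by
        rw [Complex.norm_real]
        exact le_abs_self _
    _ ≤ ∑ x : ZMod N, ∑ y : ZMod N, ‖f x‖ * ‖f y‖ * V := by
        rw [sum_norm_sq_expSum_mul]
        refine (norm_sum_le _ _).trans (sum_le_sum fun x _ => (norm_sum_le _ _).trans
          (sum_le_sum fun y _ => ?_))
        rw [norm_mul, norm_mul, RCLike.norm_conj]
        gcongr
        exact hw _
    _ = (∑ x, ‖f x‖) ^ 2 * V := by
        rw [sq, sum_mul_sum, sum_mul]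
        simp only [sum_mul]
    _ ≤ _ := by
        gcongr
        exact sum_norm_le_of_support hfL hfB

end Restricted

lemma le_add_pow_div {y l : ℝ} (hy : 0 ≤ y) (hl : 0 < l) (t : ℕ) :
    y ≤ l + y ^ (t + 1) / l ^ t := by
  rcases le_total y l with h | h
  · have : 0 ≤ y ^ (t + 1) / l ^ t := by positivity
    linarith
  · have : y ≤ y ^ (t + 1) / l ^ t := by
      rw [le_div_iff₀ (by positivity), pow_succ']
      gcongr
    linarith

/-- The hypotheses of the restriction theorem on the range, the level and the polynomial. -/
structure Admissible (A : ℝ) (N R : ℕ) (a b : Fin k → ℤ) : Prop where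
  one_le_N : 1 ≤ N
  one_le_R : 1 ≤ R
  R_le : (R : ℝ) ≤ A * (N : ℝ) ^ (1 / 10 : ℝ)
  gamma_pos : ∀ m : ℕ, 1 ≤ m → 0 < gamma a b m
  coeff_le : ∀ j, |a j| ≤ (N : ℤ) ∧ |b j| ≤ (N : ℤ)
  F_ne_zero : ∀ n : ℕ, 1 ≤ n → n ≤ N → F a b (n : ℤ) ≠ 0

/-- The cut between small and large moduli is at the support size `M`. The condition `M^(t+4) ≤ N`
gives `M^(t+1) ≤ N` for the moment of order `t + 1` and `M⁴ ≤ N` for the large moduli. -/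
lemma exists_small_support_le (hk : 1 ≤ k) {A ε : ℝ} (hA : 0 < A) (hε : 0 < ε) (hε1 : ε ≤ 1)
    {t : ℕ} (ht : 1 ≤ ε * t) :
    ∃ C : ℝ, 0 < C ∧ ∀ (N R : ℕ) [NeZero N] (a b : Fin k → ℤ), Admissible A N R a b →
      ∀ (f : ZMod N → ℂ) (B : Finset (ZMod N)) (L : ℝ), 0 ≤ L → (∀ x, ‖f x‖ ≤ L) →
        (∀ x, x ∉ B → f x = 0) → 1 ≤ B.card → B.card ^ (t + 4) ≤ N →
        ∑ n ∈ Icc 1 N, ‖expSum f n‖ ^ 2 * beta a b R n ≤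
          C * N * (L ^ 2 * (B.card : ℝ) ^ (1 + ε)) := by
  have hk' : (1 : ℝ) ≤ k := by exact_mod_cast hk
  have hC : (1 : ℝ) ≤ k * (k + 1) := by nlinarith
  have hD : (1 : ℝ) ≤ 4 * (k * (k + 1)) := by linarith
  have hDC : (1 : ℝ) ≤ 4 * (k * (k + 1)) * (k * (k + 1)) := by nlinarith
  obtain ⟨K₁, hK₁, h₁⟩ := exists_moment_le hk hDC (t + 1) hε
  obtain ⟨K₂, hK₂, h₂⟩ := exists_tail_le hk hA hD hε hε1
  refine ⟨1 + K₁ + 2 * K₂, by positivity, ?_⟩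
  intro N R _ a b hadm f B L hL hfL hfB hB1 hBN
  obtain ⟨hN, hR, hRN, hγ, -, -⟩ := hadm
  obtain ⟨W, hW, hβ⟩ := exists_beta_expansion a b hk hγ hR
  set M := B.card with hM
  have hM1 : (1 : ℝ) ≤ M := by exact_mod_cast hB1
  have hM0 : (0 : ℝ) < M := by linarith
  have hN0 : (0 : ℝ) < N := by exact_mod_cast hN
  have hpow : ∀ j ≤ t + 4, M ^ j ≤ N := fun j hj => (Nat.pow_le_pow_right hB1 hj).trans hBN
  let low : ℕ → ℝ := fun n => ∑ m ∈ (Icc 1 (R ^ 2)).filter Squarefree with ¬ M < m,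
    W m * psiProd a b m n
  let tail : ℕ → ℝ := fun n => ∑ m ∈ (Icc 1 (R ^ 2)).filter Squarefree with M < m,
    W m * psiProd a b m n
  let Λ : ℕ → ℝ := fun n => ∑ m ∈ Icc 1 M with Squarefree m,
    (4 * (k * (k + 1)) * (k * (k + 1)) : ℝ) ^ m.primeFactors.card *
      (Int.gcd (m : ℤ) (F a b n) / m : ℝ)
  have hsplit : ∀ n : ℕ, beta a b R n = tail n + low n := fun n => by
    rw [hβ]
    exact (sum_filter_add_sum_filter_not _ _ _).symm
  have hΛ0 : ∀ n, 0 ≤ Λ n := fun n => sum_nonneg fun _ _ => by positivity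
  have hlow : ∀ n, low n ≤ Λ n := by
    intro n
    have hsub : ((Icc 1 (R ^ 2)).filter Squarefree).filter (fun m => ¬ M < m) ⊆
        (Icc 1 M).filter Squarefree := by
      intro m hm
      simp only [mem_filter, mem_Icc, not_lt] at hm ⊢
      exact ⟨⟨hm.1.1.1, hm.2⟩, hm.1.2⟩
    refine le_trans ?_ (sum_le_sum_of_subset_of_nonneg hsub fun _ _ _ => by positivity)
    refine sum_le_sum fun m hm => ?_
    have hsq := (mem_filter.1 (mem_filter.1 hm).1).2
    refine (le_abs_self _).trans ?_
    rw [abs_mul, mul_pow, mul_assoc]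
    exact mul_le_mul (hW m) (abs_psiProd_le a b hk hγ hsq n) (abs_nonneg _) (by positivity)
  have hparseval : ∑ n ∈ Icc 1 N, ‖expSum f n‖ ^ 2 ≤ N * (M * L ^ 2) := by
    rw [sum_norm_sq_expSum]
    gcongr
    exact sum_norm_sq_le_of_support hfL hfB
  have hlowsum : ∑ n ∈ Icc 1 N, ‖expSum f n‖ ^ 2 * low n ≤
      (1 + K₁) * N * (L ^ 2 * (M : ℝ) ^ (1 + ε)) := by
    have hlam : (0 : ℝ) < (M : ℝ) ^ ε := by positivity
    -- With threshold `λ = M^ε`, the excess of `Λ` over `λ` is at most `Λ^(t+1)/λ^t ≤ Λ^(t+1)/M`.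
    -- This saves one factor `M` from the trivial bound `(ML)²`.
    have hlamt : (M : ℝ) ≤ ((M : ℝ) ^ ε) ^ t := by
      rw [← Real.rpow_natCast, ← Real.rpow_mul hM0.le]
      calc (M : ℝ) = (M : ℝ) ^ (1 : ℝ) := (Real.rpow_one _).symm
        _ ≤ _ := Real.rpow_le_rpow_of_exponent_le hM1 ht
    calc ∑ n ∈ Icc 1 N, ‖expSum f n‖ ^ 2 * low n
        ≤ ∑ n ∈ Icc 1 N, ((M : ℝ) ^ ε * ‖expSum f n‖ ^ 2 + M * L ^ 2 * Λ n ^ (t + 1)) := by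
          refine sum_le_sum fun n _ => ?_
          have h3 := le_add_pow_div (hΛ0 n) hlam t
          have h4 : ‖expSum f n‖ ^ 2 ≤ (M * L) ^ 2 :=
            pow_le_pow_left₀ (norm_nonneg _) (norm_expSum_le hfL hfB n) 2
          have h5 : 0 ≤ Λ n ^ (t + 1) := pow_nonneg (hΛ0 n) _
          calc ‖expSum f n‖ ^ 2 * low n
              ≤ ‖expSum f n‖ ^ 2 * ((M : ℝ) ^ ε + Λ n ^ (t + 1) / ((M : ℝ) ^ ε) ^ t) := by
                gcongr
                exact (hlow n).trans h3
            _ = (M : ℝ) ^ ε * ‖expSum f n‖ ^ 2 +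
                  ‖expSum f n‖ ^ 2 * (Λ n ^ (t + 1) / ((M : ℝ) ^ ε) ^ t) := by ring
            _ ≤ (M : ℝ) ^ ε * ‖expSum f n‖ ^ 2 + (M * L) ^ 2 * (Λ n ^ (t + 1) / M) := by
                gcongr
            _ = _ := by field_simp
      _ = (M : ℝ) ^ ε * ∑ n ∈ Icc 1 N, ‖expSum f n‖ ^ 2 +
            M * L ^ 2 * ∑ n ∈ Icc 1 N, Λ n ^ (t + 1) := by
          rw [sum_add_distrib, mul_sum, mul_sum]
      _ ≤ (M : ℝ) ^ ε * (N * (M * L ^ 2)) + M * L ^ 2 * (K₁ * N * (M : ℝ) ^ ε) := by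
          gcongr
          exact h₁ N M a b hγ hB1 (hpow _ (by omega))
      _ = _ := by
          rw [Real.rpow_add hM0, Real.rpow_one]
          ring
  have htailsum : ∑ n ∈ Icc 1 N, ‖expSum f n‖ ^ 2 * tail n ≤
      2 * K₂ * N * (L ^ 2 * (M : ℝ) ^ (1 + ε)) := by
    have h3 := sum_norm_sq_expSum_mul_le_of_fourier hfL hfB (w := tail)
      (fun x => h₂ N R M a b W hN hB1 hRN hγ hW x)
    refine h3.trans ?_
    -- The exponent `3/10` complements the error term `N^(7/10)`, and it is available because `M ≤
    -- N^(1/4)`.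
    have h4 : (M : ℝ) ≤ (N : ℝ) ^ (3 / 10 : ℝ) := by
      have h5 : (M : ℝ) ^ (4 : ℕ) ≤ N := by exact_mod_cast hpow 4 (by omega)
      calc (M : ℝ) = ((M : ℝ) ^ (4 : ℕ)) ^ (1 / 4 : ℝ) := by
            rw [← Real.rpow_natCast, ← Real.rpow_mul hM0.le]
            norm_num
        _ ≤ (N : ℝ) ^ (1 / 4 : ℝ) := Real.rpow_le_rpow (by positivity) h5 (by norm_num)
        _ ≤ _ := Real.rpow_le_rpow_of_exponent_le (by exact_mod_cast hN) (by norm_num)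
    have h5 : (M : ℝ) ^ 2 * (N * (M : ℝ) ^ (ε - 1)) = N * (M : ℝ) ^ (1 + ε) := by
      rw [Real.rpow_sub_one hM0.ne', Real.rpow_add hM0, Real.rpow_one]
      field_simp
    have h6 : (M : ℝ) ^ 2 * (N : ℝ) ^ (7 / 10 : ℝ) ≤ N * (M : ℝ) ^ (1 + ε) := by
      calc (M : ℝ) ^ 2 * (N : ℝ) ^ (7 / 10 : ℝ) = M * M * (N : ℝ) ^ (7 / 10 : ℝ) := by ring
        _ ≤ (M : ℝ) ^ (1 + ε) * (N : ℝ) ^ (3 / 10 : ℝ) * (N : ℝ) ^ (7 / 10 : ℝ) := by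
          gcongr
          calc (M : ℝ) = (M : ℝ) ^ (1 : ℝ) := (Real.rpow_one _).symm
            _ ≤ _ := Real.rpow_le_rpow_of_exponent_le hM1 (by linarith)
        _ = _ := by
          rw [mul_assoc, ← Real.rpow_add hN0]
          norm_num
          ring
    calc _ = K₂ * L ^ 2 * ((M : ℝ) ^ 2 * (N * (M : ℝ) ^ (ε - 1)) +
              (M : ℝ) ^ 2 * (N : ℝ) ^ (7 / 10 : ℝ)) := by ring
      _ ≤ K₂ * L ^ 2 * (N * (M : ℝ) ^ (1 + ε) + N * (M : ℝ) ^ (1 + ε)) := by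
          rw [h5]
          gcongr
      _ = _ := by ring
  calc ∑ n ∈ Icc 1 N, ‖expSum f n‖ ^ 2 * beta a b R n
      = ∑ n ∈ Icc 1 N, ‖expSum f n‖ ^ 2 * tail n + ∑ n ∈ Icc 1 N, ‖expSum f n‖ ^ 2 * low n := by
        rw [← sum_add_distrib]
        exact sum_congr rfl fun n _ => by rw [hsplit, mul_add]
    _ ≤ _ := add_le_add htailsum hlowsum
    _ = _ := by ring

lemma exists_restricted_le (hk : 1 ≤ k) {A ε : ℝ} (hA : 0 < A) (hε : 0 < ε) (hε1 : ε ≤ 1) :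
    ∃ C : ℝ, 0 < C ∧ ∀ (N R : ℕ) [NeZero N] (a b : Fin k → ℤ), Admissible A N R a b →
      ∀ (f : ZMod N → ℂ) (B : Finset (ZMod N)) (L : ℝ), 0 ≤ L → (∀ x, ‖f x‖ ≤ L) →
        (∀ x, x ∉ B → f x = 0) →
        ∑ n ∈ Icc 1 N, ‖expSum f n‖ ^ 2 * beta a b R n ≤
          C * N * (L ^ 2 * (B.card : ℝ) ^ (1 + ε)) := by
  obtain ⟨t, ht⟩ := exists_nat_ge (1 / ε)
  have ht' : 1 ≤ ε * t := by rwa [div_le_iff₀ hε, mul_comm] at ht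
  obtain ⟨C, hC, h₁⟩ := exists_small_support_le hk hA hε hε1 ht'
  have ht4 : (0 : ℝ) < (t + 4 : ℕ) := by positivity
  obtain ⟨K, hK, h₂⟩ := exists_beta_le hk hA (show 0 < ε / (t + 4 : ℕ) by positivity)
  refine ⟨C + K, by positivity, ?_⟩
  intro N R _ a b hadm f B L hL hfL hfB
  have hN0 : (0 : ℝ) < N := by exact_mod_cast hadm.one_le_N
  rcases Nat.eq_zero_or_pos B.card with hB0 | hB0
  · have hf0 : ∀ n, expSum f n = 0 := fun n => by
      refine sum_eq_zero fun x _ => ?_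
      rw [hfB x (by simp [card_eq_zero.1 hB0]), zero_mul]
    simp only [hf0, norm_zero, zero_pow two_ne_zero, zero_mul, sum_const_zero]
    positivity
  have hM0 : (0 : ℝ) < B.card := by exact_mod_cast hB0
  -- When the support is large, `N^(ε/(t+4)) ≤ |B|^ε`, so the pointwise bound for `β_R` costs only
  -- the permitted factor.
  rcases le_or_gt (B.card ^ (t + 4)) N with hBN | hBN
  · refine (h₁ N R a b hadm f B L hL hfL hfB hB0 hBN).trans ?_
    gcongr
    linarith
  · have hNε : (N : ℝ) ^ (ε / (t + 4 : ℕ)) ≤ (B.card : ℝ) ^ ε := by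
      calc (N : ℝ) ^ (ε / (t + 4 : ℕ)) ≤ ((B.card : ℝ) ^ (t + 4 : ℕ)) ^ (ε / (t + 4 : ℕ)) :=
            Real.rpow_le_rpow hN0.le (by exact_mod_cast hBN.le) (by positivity)
        _ = _ := by
          rw [← Real.rpow_natCast, ← Real.rpow_mul hM0.le, mul_div_cancel₀ _ ht4.ne']
    calc ∑ n ∈ Icc 1 N, ‖expSum f n‖ ^ 2 * beta a b R n
        ≤ ∑ n ∈ Icc 1 N, ‖expSum f n‖ ^ 2 * (K * (B.card : ℝ) ^ ε) := by
          refine sum_le_sum fun n hn => ?_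
          rw [mem_Icc] at hn
          gcongr
          exact (h₂ N R a b hadm.one_le_N hadm.one_le_R hadm.R_le hadm.gamma_pos hadm.coeff_le
            n hn.1 hn.2 (hadm.F_ne_zero n hn.1 hn.2)).trans (by gcongr)
      _ = (N * ∑ x, ‖f x‖ ^ 2) * (K * (B.card : ℝ) ^ ε) := by
          rw [← sum_mul, sum_norm_sq_expSum]
      _ ≤ (N * (B.card * L ^ 2)) * (K * (B.card : ℝ) ^ ε) := by
          gcongr
          exact sum_norm_sq_le_of_support hfL hfB
      _ = K * N * (L ^ 2 * (B.card : ℝ) ^ (1 + ε)) := by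
          rw [Real.rpow_add hM0, Real.rpow_one]
          ring
      _ ≤ _ := by
          gcongr
          linarith

end

section

variable {k : ℕ}

/-! ### From the restricted estimate to the full one -/

lemma geom_sum_le_inv {ρ : ℝ} (hρ : 0 < ρ) (hρ1 : ρ < 1) (J : ℕ) :
    ∑ j ∈ range J, ρ ^ j ≤ (1 - ρ)⁻¹ := by
  rw [← one_div, le_div_iff₀ (by linarith), mul_comm, mul_neg_geom_sum]
  have : 0 < ρ ^ J := by positivity
  linarith

/-- Cauchy-Schwarz with weights `ρ^j`, so that the constant does not depend on the number `J` of
levels. -/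
lemma norm_sum_sq_le_geom {ρ : ℝ} (hρ : 0 < ρ) (hρ1 : ρ < 1) (g : ℕ → ℂ) (J : ℕ) :
    ‖∑ j ∈ range J, g j‖ ^ 2 ≤ (1 - ρ)⁻¹ * ∑ j ∈ range J, (ρ ^ j)⁻¹ * ‖g j‖ ^ 2 := by
  calc ‖∑ j ∈ range J, g j‖ ^ 2 ≤ (∑ j ∈ range J, ‖g j‖) ^ 2 :=
        pow_le_pow_left₀ (norm_nonneg _) (norm_sum_le _ _) 2
    _ ≤ (∑ j ∈ range J, ρ ^ j) * ∑ j ∈ range J, (ρ ^ j)⁻¹ * ‖g j‖ ^ 2 := by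
        refine sum_sq_le_sum_mul_sum_of_sq_le_mul _ (fun j _ => by positivity)
          (fun j _ => by positivity) fun j _ => le_of_eq ?_
        field_simp
    _ ≤ _ := by
        gcongr
        exact geom_sum_le_inv hρ hρ1 J

lemma exists_level {S y : ℝ} (hy : 0 < y) (hyS : y ≤ S) :
    ∃ n : ℕ, 2 ^ n * y ≤ S ∧ S < 2 ^ (n + 1) * y := by
  obtain ⟨n, h1, h2⟩ := exists_nat_pow_near ((one_le_div hy).2 hyS) (one_lt_two (α := ℝ))
  exact ⟨n, (le_div_iff₀ hy).1 h1, (div_lt_iff₀ hy).1 h2⟩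

lemma exists_restriction_le (hk : 1 ≤ k) {A q : ℝ} (hA : 0 < A) (hq₁ : 1 < q) (hq₂ : q < 2) :
    ∃ C : ℝ, 0 < C ∧ ∀ (N R : ℕ) [NeZero N] (a b : Fin k → ℤ), Admissible A N R a b →
      ∀ f : ZMod N → ℂ,
        ∑ n ∈ Icc 1 N, ‖expSum f n‖ ^ 2 * beta a b R n ≤
          C * N * (∑ x, ‖f x‖ ^ q) ^ (2 / q) := by
  have hq0 : 0 < q := by linarith
  -- This choice makes `q(1 + ε) = 1 + q/2`, midway between `q` and `2`.
  set ε : ℝ := (2 - q) / (2 * q) with hεdef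
  have hε : 0 < ε := div_pos (by linarith) (by linarith)
  have hε1 : ε ≤ 1 := by
    rw [hεdef, div_le_one (by linarith)]
    linarith
  set σ : ℝ := 1 + q / 2 with hσ
  have hqσ : q * (1 + ε) = σ := by
    rw [hεdef, hσ]
    field_simp
    ring
  -- Level `j` contributes a multiple of `4^(-j) 2^(σj) = ρ^(2j)`. One factor `ρ^j` pays for the
  -- Cauchy-Schwarz weight and the other makes the series converge.
  set ρ : ℝ := 2 ^ ((σ - 2) / 2) with hρdef
  have hρ : 0 < ρ := by positivity
  have hρ1 : ρ < 1 := Real.rpow_lt_one_of_one_lt_of_neg one_lt_two (by rw [hσ]; linarith)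
  have hρσ : (2 : ℝ) ^ σ = 4 * ρ ^ 2 := by
    rw [hρdef, ← Real.rpow_natCast, ← Real.rpow_mul (by norm_num),
      show (4 : ℝ) = 2 ^ (2 : ℝ) by norm_num, ← Real.rpow_add (by norm_num)]
    congr 1
    push_cast
    ring
  have h1ρ : 0 < (1 - ρ)⁻¹ := inv_pos.2 (by linarith)
  obtain ⟨C, hC, h⟩ := exists_restricted_le hk hA hε hε1
  refine ⟨(1 - ρ)⁻¹ * (C * 2 ^ σ * (1 - ρ)⁻¹), by positivity, ?_⟩
  intro N R _ a b hadm f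
  set S : ℝ := (∑ x, ‖f x‖ ^ q) ^ (1 / q) with hS
  have hsum0 : 0 ≤ ∑ x, ‖f x‖ ^ q := sum_nonneg fun _ _ => by positivity
  have hS0 : 0 ≤ S := Real.rpow_nonneg hsum0 _
  have hSq : S ^ q = ∑ x, ‖f x‖ ^ q := by
    rw [hS, ← Real.rpow_mul hsum0, one_div_mul_cancel hq0.ne', Real.rpow_one]
  have hS2 : (∑ x, ‖f x‖ ^ q) ^ (2 / q) = S ^ 2 := by
    rw [hS, ← Real.rpow_natCast, ← Real.rpow_mul hsum0]
    congr 1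
    push_cast
    ring
  have hfS : ∀ x, ‖f x‖ ≤ S := by
    intro x
    refine (Real.rpow_le_rpow_iff (norm_nonneg _) hS0 hq0).1 ?_
    rw [hSq]
    exact single_le_sum (f := fun x => ‖f x‖ ^ q) (fun _ _ => by positivity) (mem_univ x)
  have hlev : ∀ x, ∃ n : ℕ, f x ≠ 0 → 2 ^ n * ‖f x‖ ≤ S ∧ S < 2 ^ (n + 1) * ‖f x‖ := by
    intro x
    by_cases hx : f x = 0
    -- Zeros of `f` receive the arbitrary level `0`; they contribute nothing and are excluded from
    -- `B`.
    · exact ⟨0, fun h => absurd hx h⟩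
    · obtain ⟨n, hn⟩ := exists_level (norm_pos_iff.2 hx) (hfS x)
      exact ⟨n, fun _ => hn⟩
  choose ℓ hℓ using hlev
  obtain ⟨J, hJ⟩ : ∃ J, ∀ x, ℓ x < J :=
    ⟨univ.sup ℓ + 1, fun x => Nat.lt_succ_of_le (le_sup (f := ℓ) (mem_univ x))⟩
  let fj : ℕ → ZMod N → ℂ := fun j x => if ℓ x = j then f x else 0
  let B : ℕ → Finset (ZMod N) := fun j => univ.filter fun x => f x ≠ 0 ∧ ℓ x = j
  have hdecomp : ∀ n, expSum f n = ∑ j ∈ range J, expSum (fj j) n := by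
    intro n
    simp only [expSum]
    rw [sum_comm]
    refine sum_congr rfl fun x _ => ?_
    rw [← sum_mul, sum_ite_eq, if_pos (mem_range.2 (hJ x))]
  -- Chebyshev's inequality: on level `j` one has `|f| > S/2^(j+1)`, while the sum of `|f|^q` is
  -- `S^q`.
  have hcard : ∀ j, ((B j).card : ℝ) ≤ (2 ^ (j + 1)) ^ q := by
    intro j
    rcases (B j).eq_empty_or_nonempty with hB | ⟨y, hy⟩
    · rw [hB, card_empty, Nat.cast_zero]
      positivity
    have hSpos : 0 < S :=
      (norm_pos_iff.2 (mem_filter.1 hy).2.1).trans_le (hfS y)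
    have h1 : (B j).card * (S / 2 ^ (j + 1)) ^ q ≤ S ^ q := by
      rw [hSq, ← nsmul_eq_mul]
      refine (card_nsmul_le_sum (B j) (fun x => ‖f x‖ ^ q) _ fun x hx => ?_).trans
        (sum_le_sum_of_subset_of_nonneg (subset_univ _) fun _ _ _ => by positivity)
      obtain ⟨-, hx0, hxj⟩ := mem_filter.1 hx
      have h2 := (hℓ x hx0).2
      rw [hxj] at h2
      refine Real.rpow_le_rpow (by positivity) ?_ hq0.le
      rw [div_le_iff₀ (by positivity), mul_comm]
      exact h2.le
    rw [Real.div_rpow hS0 (by positivity), ← mul_div_assoc, div_le_iff₀ (by positivity),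
      mul_comm] at h1
    exact le_of_mul_le_mul_left h1 (by positivity)
  have hpiece : ∀ j, ∑ n ∈ Icc 1 N, ‖expSum (fj j) n‖ ^ 2 * beta a b R n ≤
      C * N * (S ^ 2 * (2 ^ σ * (ρ ^ j) ^ 2)) := by
    intro j
    refine (h N R a b hadm (fj j) (B j) (S / 2 ^ j) (by positivity) ?_ ?_).trans ?_
    · intro x
      simp only [fj]
      split_ifs with hx
      · by_cases hx0 : f x = 0
        · rw [hx0, norm_zero]
          positivity
        · have h2 := (hℓ x hx0).1
          rw [hx] at h2
          rw [le_div_iff₀ (by positivity), mul_comm]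
          exact h2
      · rw [norm_zero]
        positivity
    · intro x hx
      simp only [fj]
      split_ifs with hxj
      · by_contra hx0
        exact hx (mem_filter.2 ⟨mem_univ _, hx0, hxj⟩)
      · rfl
    · refine mul_le_mul_of_nonneg_left ?_ (by positivity)
      calc (S / 2 ^ j) ^ 2 * ((B j).card : ℝ) ^ (1 + ε)
          ≤ (S / 2 ^ j) ^ 2 * (((2 : ℝ) ^ (j + 1)) ^ q) ^ (1 + ε) := by
            gcongr
            exact hcard j
        _ = S ^ 2 * (2 ^ σ * (ρ ^ j) ^ 2) := by
            rw [← Real.rpow_mul (by positivity), hqσ, ← Real.rpow_natCast 2 (j + 1),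
              ← Real.rpow_mul (by norm_num), mul_comm ((j + 1 : ℕ) : ℝ) σ,
              Real.rpow_mul (by norm_num), Real.rpow_natCast, hρσ]
            have h4 : (4 : ℝ) ^ j = (2 ^ j) ^ 2 := by
              rw [pow_right_comm]
              norm_num
            have hj0 : (2 : ℝ) ^ j ≠ 0 := by positivity
            calc _ = S ^ 2 * (4 ^ j * (ρ ^ j) ^ 2 * (4 * ρ ^ 2)) / (2 ^ j) ^ 2 := by ring
              _ = _ := by
                rw [h4]
                field_simp
  rw [hS2]
  calc ∑ n ∈ Icc 1 N, ‖expSum f n‖ ^ 2 * beta a b R n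
      ≤ ∑ n ∈ Icc 1 N, ((1 - ρ)⁻¹ * ∑ j ∈ range J, (ρ ^ j)⁻¹ * ‖expSum (fj j) n‖ ^ 2) *
          beta a b R n := by
        refine sum_le_sum fun n _ => ?_
        refine mul_le_mul_of_nonneg_right ?_ (beta_nonneg a b hadm.gamma_pos hadm.one_le_R n)
        rw [hdecomp]
        exact norm_sum_sq_le_geom hρ hρ1 _ J
    _ = (1 - ρ)⁻¹ * ∑ j ∈ range J, (ρ ^ j)⁻¹ *
          ∑ n ∈ Icc 1 N, ‖expSum (fj j) n‖ ^ 2 * beta a b R n := by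
        simp only [mul_sum, sum_mul]
        rw [sum_comm]
        exact sum_congr rfl fun _ _ => sum_congr rfl fun _ _ => by ring
    _ ≤ (1 - ρ)⁻¹ * ∑ j ∈ range J, (ρ ^ j)⁻¹ * (C * N * (S ^ 2 * (2 ^ σ * (ρ ^ j) ^ 2))) := by
        gcongr with j _
        exact hpiece j
    _ = (1 - ρ)⁻¹ * (C * 2 ^ σ * N * S ^ 2 * ∑ j ∈ range J, ρ ^ j) := by
        congr 1
        rw [mul_sum]
        refine sum_congr rfl fun j _ => ?_
        have : ρ ^ j ≠ 0 := by positivity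
        field_simp
    _ ≤ (1 - ρ)⁻¹ * (C * 2 ^ σ * N * S ^ 2 * (1 - ρ)⁻¹) := by
        gcongr
        exact geom_sum_le_inv hρ hρ1 J
    _ = _ := by ring

end

end EnvelopingSieve

end

/-! ### The normalised restriction estimate -/

theorem proposition4p1 (k : ℕ) (hk : 1 ≤ k) (q : ℝ) (hq₁ : 1 < q) (hq₂ : q < 2)
    (A : ℝ) (hA : 0 < A) :
    ∃ C : ℝ, 0 < C ∧
      ∀ (N R : ℕ) [NeZero N] (a b : Fin k → ℤ),
        1 ≤ R → (R : ℝ) ≤ A * (N : ℝ) ^ (1 / 10 : ℝ) →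
        (∀ j, a j ≠ 0) →
        EnvelopingSieve.disc a b ≠ 0 →
        (∀ m : ℕ, 1 ≤ m → 0 < EnvelopingSieve.gamma a b m) →
        (∀ j, |a j| ≤ (N : ℤ) ∧ |b j| ≤ (N : ℤ)) →
        (∀ n : ℕ, 1 ≤ n → n ≤ N → EnvelopingSieve.F a b (n : ℤ) ≠ 0) →
        ∀ f : ZMod N → ℂ,
          (∑ n ∈ Finset.Icc 1 N,
              ‖∑ x : ZMod N, f x * EnvelopingSieve.e N ((x.val : ℤ) * (n : ℤ))‖ ^ 2 *
                EnvelopingSieve.beta a b R (n : ℤ)) / (N : ℝ)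
            ≤ C * (∑ x : ZMod N, ‖f x‖ ^ q) ^ (2 / q) := by
  obtain ⟨C, hC, h⟩ := EnvelopingSieve.exists_restriction_le hk hA hq₁ hq₂
  refine ⟨C, hC, ?_⟩
  intro N R _ a b hR hRN _ _ hγ hab hF f
  have hN : 1 ≤ N := Nat.pos_of_ne_zero (NeZero.ne N)
  rw [div_le_iff₀ (by exact_mod_cast hN)]
  refine (h N R a b ⟨hN, hR, hRN, hγ, hab, hF⟩ f).trans (le_of_eq ?_)
  ring
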